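/- Let $N,M$ be natural numbers and $\mathrm{UM}(N,M)=\{X\in\mathbb C^{N\times M}:|X_{nm}|=1\text{ for all }n,m\}$. On $\mathcal M=\mathbb R\times\mathrm{UM}(N,M)$ use the metric induced from $\mathbb R\times\mathbb C^{N\times M}$ with $\langle\xi,\eta\rangle=\operatorname{Re}\operatorname{Tr}(\xi^H\eta)$ on the second factor. Let $P_X Z=Z-\operatorname{Re}(Z\circ X^*)\circ X$ be the projection onto $T_X\mathrm{UM}(N,M)$, $\operatorname{grad}F(\alpha,X)=(\partial_\alpha F,\,P_X\nabla_XF)$ the Riemannian gradient, $R_{(\alpha,X)}(\xi_\alpha,\xi_X)=\bigl(\alpha+\xi_\alpha,\ ((X+\xi_X)_{nm}/|(X+\xi_X)_{nm}|)_{n,m}\bigr)$ the retraction, and $\mathcal T_{(\beta,Y)}(\xi_\alpha,\xi_X)=(\xi_\alpha,P_Y\xi_X)$ the vector transport to the point $(\beta,Y)$. Let $\Theta,\hat\Theta$ be finite sets of angles, $\mathcal D$ a finite set of delays $\tau\in\{0,1,2,\dots\}$, $a_\theta\in\mathbb C^M$ steering vectors, $\bar P_\theta\in\mathbb R$ a desired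 beampattern, and $w\in\mathbb R$ ($w=1$ is the unweighted case). Let $S_\tau$ be the $N\times N$ shift matrix with $(S_\tau)_{n,k}=1$ if $k=n+\tau$ and $0$ otherwise, and $P_{\theta,\theta',\tau}(X)=a_\theta^HX^HS_\tau Xa_{\theta'}$. Put $$e_\theta(\alpha,X)=|\alpha\bar P_\theta-a_\theta^HX^HXa_\theta|^2,\qquad P_\tau(X)=\mathbf 1_{\tau\ne0}\sum_{\theta\in\hat\Theta}|P_{\theta,\theta,\tau}(X)|^2+\sum_{\theta\ne\theta'\in\hat\Theta}|P_{\theta,\theta',\tau}(X)|^2,$$ $$f(\alpha,X)=\sum_{\theta\in\Theta}e_\theta(\alpha,X)+w^2\sum_{\tau\in\mathcal D}P_\tau(X).$$ UM-SVRG algorithm. Given are real numbers $c_1,c_2$, integers $m_l>0$ and step sizes $t^l_q>0$ ($l\ge1$, $0\le q<m_l$), and a starting point $\tilde x^0\in\mathcal M$. For $l=1,2,\dots$ put $x^l_0=\tilde x^{l-1}$; for $q=0,\dots,m_l-1$ draw $\theta\in\Theta$ and $\tau\in\mathcal D$, each uniformly at random, the pairs $(\theta,\tau)$ of all iterations being independent,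 put $f_i=c_1e_\theta+c_2w^2P_\tau$ and $$\varsigma=\operatorname{grad}f_i(x^l_q)-\mathcal T_{x^l_q}\bigl(\operatorname{grad}f_i(\tilde x^{l-1})-\operatorname{grad}f(\tilde x^{l-1})\bigr),\qquad x^l_{q+1}=R_{x^l_q}(-t^l_q\,\varsigma);$$ finally put $\tilde x^l=x^l_{m_l}$. Theorem. Suppose that $$\sum_{l=1}^\infty\sum_{q=0}^{m_l-1}(t^l_q)^2<\infty,\qquad\sum_{l=1}^\infty\sum_{q=0}^{m_l-1}t^l_q=\infty,$$ and that either $c_1=|\Theta|$ and $c_2=|\mathcal D|$ (so that $f$ is the average of the losses $f_i$, that is, $\mathbb E f_i=f$; the $m_l$ are then arbitrary), or $\sup_lm_l<\infty$ (with $c_1,c_2$ arbitrary, for instance $c_1=c_2=1$). Then almost surely the objective values $f(x^l_q)$, $0\le q\le m_l$, converge to a finite limit as $l\to\infty$, $\operatorname{grad}f(x^l_q)\to0$, and the algorithm converges in the sense that every accumulation point of the iterates is a point of $\mathcal M$ at which $\operatorname{grad}f=0$. -/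

import Mathlib

open Filter Topology MeasureTheory ProbabilityTheory Finset
open scoped Matrix BigOperators ComplexConjugate

noncomputable section

namespace UMSVRG

/-- `ℂ^{N × M}` as a Euclidean space; as a real inner product space its inner product is
`Re (Tr (ξᴴ η))`. -/
abbrev Wave (N M : ℕ) : Type := EuclideanSpace ℂ (Fin N × Fin M)

/-- The ambient space `ℝ × ℂ^{N × M}` of the pairs `(α, X)`. -/
abbrev Pt (N M : ℕ) : Type := ℝ × Wave N M

/-- The `N × M` matrix with the given entries. -/
def toMat {N M : ℕ} (X : Wave N M) : Matrix (Fin N) (Fin M) ℂ :=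
  Matrix.of fun n m => X (n, m)

/-! ### The manifold `ℝ × UM(N, M)` and its operators -/

/-- Matrices all of whose entries have modulus one. -/
def UM (N M : ℕ) : Set (Wave N M) := {X | ∀ p, ‖X p‖ = 1}

/-- The product manifold `ℝ × UM(N, M)`. -/
def manifold (N M : ℕ) : Set (Pt N M) := {x | x.2 ∈ UM N M}

/-- The tangent space `{ξ | Re (ξ ∘ X*) = 0}` of `UM(N, M)` at `X`. -/
def tangent {N M : ℕ} (X : Wave N M) : Set (Wave N M) :=
  {ξ | ∀ p, (ξ p * conj (X p)).re = 0}

/-- The projection `Z ↦ Z - Re (Z ∘ X*) ∘ X` onto the tangent space at `X`. -/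
def tproj {N M : ℕ} (X Z : Wave N M) : Wave N M :=
  WithLp.toLp 2 fun p => Z p - ((Z p * conj (X p)).re : ℂ) * X p

/-- Together with the next lemma: at `X ∈ UM(N, M)` the map `tproj X` is the orthogonal projection
onto the tangent space. -/
theorem tproj_mem_tangent {N M : ℕ} {X : Wave N M} (hX : X ∈ UM N M) (Z : Wave N M) :
    tproj X Z ∈ tangent X := by
  intro p
  have h : (X p).re * (X p).re + (X p).im * (X p).im = 1 := by
    have h1 := hX p
    have h2 := Complex.normSq_eq_norm_sq (X p)
    rw [h1, Complex.normSq_apply] at h2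
    simpa using h2
  simp only [tproj, Complex.mul_re, Complex.sub_re, Complex.sub_im, Complex.conj_re,
    Complex.conj_im, Complex.mul_im, Complex.ofReal_re, Complex.ofReal_im]
  linear_combination (-((Z p).re * (X p).re + (Z p).im * (X p).im)) * h

theorem inner_sub_tproj {N M : ℕ} (X Z ξ : Wave N M) (hξ : ξ ∈ tangent X) :
    inner ℝ ξ (Z - tproj X Z) = 0 := by
  rw [PiLp.inner_apply]
  refine Finset.sum_eq_zero fun p _ => ?_
  have h2 := hξ p
  simp only [Complex.mul_re, Complex.conj_re, Complex.conj_im] at h2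
  simp only [tproj, PiLp.sub_apply, Complex.inner, Complex.mul_re, Complex.sub_re,
    Complex.sub_im, Complex.conj_re, Complex.conj_im, Complex.mul_im, Complex.ofReal_re,
    Complex.ofReal_im]
  linear_combination ((Z p).re * (X p).re + (Z p).im * (X p).im) * h2

/-- The Riemannian gradient `(∇_α F, P_X ∇_X F)` on `ℝ × UM(N, M)`. -/
def grad {N M : ℕ} (F : Pt N M → ℝ) (x : Pt N M) : Pt N M :=
  (deriv (fun a => F (a, x.2)) x.1, tproj x.2 (gradient (fun X => F (x.1, X)) x.2))

/-- The retraction: the real coordinates are added, the entries of `X + ξ` are divided by their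
moduli (which are at least `1` for `X ∈ UM(N, M)` and `ξ` tangent at `X`). -/
def retract {N M : ℕ} (x ξ : Pt N M) : Pt N M :=
  (x.1 + ξ.1, WithLp.toLp 2 fun p => (x.2 p + ξ.2 p) / (‖x.2 p + ξ.2 p‖ : ℂ))

/-- The vector transport of `ξ` to the tangent space at the point `y`: the transport of `ξ` along
`η` is the projection of `ξ` at the endpoint `y = R(η)`, so that it depends on `η` only
through `y`. -/
def transport {N M : ℕ} (y ξ : Pt N M) : Pt N M := (ξ.1, tproj y.2 ξ.2)

/-! ### The objective function -/

/-- The data of the waveform design problem. -/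
structure Problem (M : ℕ) where
  /-- the angles at which the beampattern is matched -/
  angles : Finset ℝ
  /-- the angles of interest for the spatial correlation -/
  corrAngles : Finset ℝ
  /-- the time delays of interest -/
  delays : Finset ℕ
  /-- the steering vectors -/
  steer : ℝ → Fin M → ℂ
  /-- the desired beampattern -/
  desired : ℝ → ℝ
  /-- the weight of the spatial correlation level is `w ^ 2` -/
  w : ℝ

/-- The time delay shift matrix. -/
def shift (N τ : ℕ) : Matrix (Fin N) (Fin N) ℂ :=
  Matrix.of fun n k => if (k : ℕ) = n + τ then 1 else 0

variable {N M : ℕ}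

/-- The synthesized signal `X a_θ`. -/
def signal (pb : Problem M) (X : Wave N M) (θ : ℝ) : Fin N → ℂ := toMat X *ᵥ pb.steer θ

/-- The spatial correlation `a_{θ₁}ᴴ Xᴴ S_τ X a_{θ₂}`. -/
def corr (pb : Problem M) (X : Wave N M) (θ₁ θ₂ : ℝ) (τ : ℕ) : ℂ :=
  star (signal pb X θ₁) ⬝ᵥ (shift N τ *ᵥ signal pb X θ₂)

/-- The loss `|α P_θ - a_θᴴ Xᴴ X a_θ|²` of one angle. -/
def angleLoss (pb : Problem M) (θ : ℝ) (x : Pt N M) : ℝ :=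
  ‖((x.1 * pb.desired θ : ℝ) : ℂ) - star (signal pb x.2 θ) ⬝ᵥ signal pb x.2 θ‖ ^ 2

/-- The spatial correlation level. -/
def corrLevel (pb : Problem M) (X : Wave N M) : ℝ :=
  ∑ τ ∈ pb.delays.erase 0, ∑ θ ∈ pb.corrAngles, ‖corr pb X θ θ τ‖ ^ 2 +
    ∑ τ ∈ pb.delays, ∑ p ∈ pb.corrAngles.offDiag, ‖corr pb X p.1 p.2 τ‖ ^ 2

/-- The part of the spatial correlation level that belongs to one delay. -/
def delayLoss (pb : Problem M) (τ : ℕ) (X : Wave N M) : ℝ :=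
  (if τ = 0 then 0 else ∑ θ ∈ pb.corrAngles, ‖corr pb X θ θ τ‖ ^ 2) +
    ∑ p ∈ pb.corrAngles.offDiag, ‖corr pb X p.1 p.2 τ‖ ^ 2

theorem sum_delayLoss (pb : Problem M) (X : Wave N M) :
    ∑ τ ∈ pb.delays, delayLoss pb τ X = corrLevel pb X := by
  simp only [delayLoss, corrLevel, Finset.sum_add_distrib]
  congr 1
  rw [← Finset.sum_filter_add_sum_filter_not pb.delays (fun τ => τ = 0)]
  rw [Finset.sum_eq_zero (s := pb.delays.filter (fun τ => τ = 0))
    (fun τ hτ => if_pos (Finset.mem_filter.1 hτ).2), zero_add]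
  refine Finset.sum_congr ?_ fun τ hτ => if_neg (Finset.ne_of_mem_erase hτ)
  ext τ
  simp [and_comm]

/-- The objective function. -/
def objective (pb : Problem M) (x : Pt N M) : ℝ :=
  ∑ θ ∈ pb.angles, angleLoss pb θ x + pb.w ^ 2 * corrLevel pb x.2

/-- The loss of the sampled pair `(θ, τ)`, with scaling factors `c₁` and `c₂`. -/
def sampleLoss (pb : Problem M) (c₁ c₂ : ℝ) (i : pb.angles × pb.delays) (x : Pt N M) : ℝ :=
  c₁ * angleLoss pb i.1 x + c₂ * (pb.w ^ 2 * delayLoss pb i.2 x.2)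

/-! ### The algorithm -/

/-- The modified stochastic gradient at `x`, with reference point `y`. -/
def modGrad (pb : Problem M) (c₁ c₂ : ℝ) (i : pb.angles × pb.delays) (y x : Pt N M) : Pt N M :=
  grad (sampleLoss pb c₁ c₂ i) x -
    transport x (grad (sampleLoss pb c₁ c₂ i) y - grad (objective pb) y)

/-- The inner loop: `t q` and `i q` are the step size and the sample that lead from the iterate
with number `q` to the next one. -/
def innerLoop (pb : Problem M) (c₁ c₂ : ℝ) (t : ℕ → ℝ) (i : ℕ → pb.angles × pb.delays)
    (y : Pt N M) : ℕ → Pt N M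
  | 0 => y
  | q + 1 =>
    let x := innerLoop pb c₁ c₂ t i y q
    retract x (-(t q) • modGrad pb c₁ c₂ (i q) y x)

/-- The outer loop: the reference points. The outer iterations are numbered from `0`. -/
def outerLoop (pb : Problem M) (c₁ c₂ : ℝ) (m : ℕ → ℕ) (t : ℕ → ℕ → ℝ)
    (i : ℕ → ℕ → pb.angles × pb.delays) (x₀ : Pt N M) : ℕ → Pt N M
  | 0 => x₀
  | l + 1 => innerLoop pb c₁ c₂ (t l) (i l) (outerLoop pb c₁ c₂ m t i x₀ l) (m l)

/-- The iterate with inner number `q` (meaningful for `q ≤ m l`) in the outer iteration `l`. -/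
def iterate (pb : Problem M) (c₁ c₂ : ℝ) (m : ℕ → ℕ) (t : ℕ → ℕ → ℝ)
    (i : ℕ → ℕ → pb.angles × pb.delays) (x₀ : Pt N M) (l q : ℕ) : Pt N M :=
  innerLoop pb c₁ c₂ (t l) (i l) (outerLoop pb c₁ c₂ m t i x₀ l) q

end UMSVRG

end

/-!
The nested loops are read as one sequence of steps `x ↦ R(-t ς)` with reference points `y`
(`run`, `run_eq_iterate`). Transport is the projection at the current point, so the modified
stochastic gradient is `ς = grad f (x) + ν` with the noise `ν = T_x (h x - h y)`, where `h` is the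
difference of the gradients of the sampled loss and of the objective (`modGrad_eq_add_noise`). The
noise is small in one of two ways. If the sampled losses are unbiased, it is centred given the past,
and series of the form `∑ t ν` are martingales with square summable steps, which converge almost
surely (`ae_seriesConverges`, `ae_run_tendsto`). If the inner loops have bounded lengths, then
`|ν| ≲ |x - y|`, which is at most a constant times the time elapsed since the reference point was
set; the products of this time with `t` are summable since `∑ t² < ∞`, so the noise is absolutely
summable for every outcome (`run_tendsto_of_summable_elapsed`).

The phases live in a compact set but `α` does not, and the Lipschitz constants of the gradients
grow with `α`. All losses are however quadratic polynomials in `α` (`QuadraticIn`): the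
`α`-component of the noise grows at most linearly in the running maximum `D` of `1 + |α|`, and that
of the gradient of the objective is `2 a α + b(X)` with `a > 0` and `b` bounded, unless no loss depends on `α`. The
series of the noise divided by `D` converges, and Abel summation shows that the contraction towards
bounded values then keeps `α` bounded (`exists_bound_of_perturbed_recursion`). Hence almost every
path stays in a compact set, and the remaining series are needed only for noise that is set to zero
once `D` exceeds some `K`.

On a compact set the objective decreases by `t |grad f|²` per step, up to the convergent series
`∑ t ⟨grad f, ν⟩` and an error `O(t²)`. So it converges, and `∑ t |grad f|² < ∞`. Since `∑ t = ∞`,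
the gradient is small infinitely often; as the vector series `∑ t ν` converges, an excursion to
larger gradients would cost a definite amount of `∑ t |grad f|²`, so that the gradient tends to zero
(`tendsto_zero_of_summable_sq`).
-/

/-! ### Real sequences -/

namespace UMSVRG

/-- Convergence of the series `∑ u k` in the given order (not necessarily absolute). -/
def SeriesConverges {V : Type*} [AddCommMonoid V] [TopologicalSpace V] (u : ℕ → V) : Prop :=
  ∃ s, Tendsto (fun n => ∑ k ∈ range n, u k) atTop (𝓝 s)

theorem SeriesConverges.exists_tail_le {V : Type*} [NormedAddCommGroup V] {u : ℕ → V}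
    (hu : SeriesConverges u) {ε : ℝ} (hε : 0 < ε) :
    ∀ᶠ k₀ in atTop, ∀ i ≥ k₀, ∀ j ≥ k₀, i ≤ j → ‖∑ k ∈ Ico i j, u k‖ ≤ ε := by
  obtain ⟨s, hs⟩ := hu
  obtain ⟨k, hk⟩ := Metric.cauchySeq_iff.1 hs.cauchySeq ε hε
  filter_upwards [eventually_ge_atTop k] with k₀ hk₀ i hi j hj hij
  rw [sum_Ico_eq_sub _ hij, ← dist_eq_norm]
  exact (hk j (hk₀.trans hj) i (hk₀.trans hi)).le

theorem SeriesConverges.add {V : Type*} [NormedAddCommGroup V] {u v : ℕ → V}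
    (hu : SeriesConverges u) (hv : SeriesConverges v) :
    SeriesConverges (fun k => u k + v k) := by
  obtain ⟨s, hs⟩ := hu
  obtain ⟨r, hr⟩ := hv
  exact ⟨s + r, by simpa [sum_add_distrib] using hs.add hr⟩

theorem SeriesConverges.neg {V : Type*} [NormedAddCommGroup V] {u : ℕ → V}
    (hu : SeriesConverges u) : SeriesConverges (fun k => -u k) := by
  obtain ⟨s, hs⟩ := hu
  exact ⟨-s, by simpa using hs.neg⟩

theorem _root_.Summable.seriesConverges {V : Type*} [NormedAddCommGroup V] {u : ℕ → V}
    (hu : Summable u) : SeriesConverges u :=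
  ⟨_, hu.hasSum.tendsto_sum_nat⟩

/-- Abel summation: a nondecreasing nonnegative weight multiplies the bound on the partial sums at
most by twice its last value. -/
theorem abs_sum_mul_le_of_monotone {D u : ℕ → ℝ} (hD : Monotone D) (hD0 : 0 ≤ D 0) {ε : ℝ}
    (hu : ∀ n, |∑ k ∈ range n, u k| ≤ ε) (n : ℕ) :
    |∑ k ∈ range n, D k * u k| ≤ 2 * ε * D n := by
  have hε : 0 ≤ ε := (abs_nonneg _).trans (hu 0)
  have key : |∑ k ∈ range n, D k * u k - D n * ∑ k ∈ range n, u k| ≤ ε * (D n - D 0) := by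
    induction n with
    | zero => simp
    | succ n ih =>
      have h1 : ∑ k ∈ range (n + 1), D k * u k - D (n + 1) * ∑ k ∈ range (n + 1), u k =
          (∑ k ∈ range n, D k * u k - D n * ∑ k ∈ range n, u k) -
            (D (n + 1) - D n) * ∑ k ∈ range (n + 1), u k := by
        rw [sum_range_succ, sum_range_succ]; ring
      have h2 : 0 ≤ D (n + 1) - D n := sub_nonneg.2 (hD n.le_succ)
      have h3 := abs_sub (∑ k ∈ range n, D k * u k - D n * ∑ k ∈ range n, u k)
        ((D (n + 1) - D n) * ∑ k ∈ range (n + 1), u k)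
      rw [abs_mul, abs_of_nonneg h2] at h3
      have h4 := mul_le_mul_of_nonneg_left (hu (n + 1)) h2
      rw [h1]
      linarith
  have hDn : 0 ≤ D n := hD0.trans (hD n.zero_le)
  have h5 : |D n * ∑ k ∈ range n, u k| ≤ D n * ε := by
    rw [abs_mul, abs_of_nonneg hDn]
    exact mul_le_mul_of_nonneg_left (hu n) hDn
  have h6 := abs_add_le (∑ k ∈ range n, D k * u k - D n * ∑ k ∈ range n, u k)
    (D n * ∑ k ∈ range n, u k)
  rw [sub_add_cancel] at h6
  nlinarith [mul_nonneg hε hD0]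

/-- The recursion `α ↦ α - t (a α + b)` with `a > 0` and bounded `b` stays bounded under
perturbations `t e` that may grow with the running maximum of `|α|`, provided that the series of
the normalized perturbations converges. -/
theorem exists_bound_of_perturbed_recursion {α t e b D : ℕ → ℝ} {a B : ℝ} (ha : 0 < a)
    (ht0 : ∀ k, 0 ≤ t k) (ht : Tendsto t atTop (𝓝 0)) (hb : ∀ k, |b k| ≤ B)
    (hα : ∀ k, α (k + 1) = α k - t k * (a * α k + b k) - t k * e k)
    (hD : D = partialSups fun k => 1 + |α k|)
    (he : SeriesConverges fun k => t k * (e k / D k)) :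
    ∃ K, ∀ k, D k ≤ K := by
  have hDm : Monotone D := hD ▸ (partialSups _).monotone
  have hαD : ∀ k, 1 + |α k| ≤ D k := fun k => by
    rw [hD]; exact le_partialSups (fun k => 1 + |α k|) k
  have hDpos : ∀ k, 0 < D k := fun k => by linarith [hαD k, abs_nonneg (α k)]
  have hB : 0 ≤ B := (abs_nonneg _).trans (hb 0)
  have h1 : ∀ᶠ k in atTop, t k < 1 / a := ht.eventually (gt_mem_nhds (by positivity))
  obtain ⟨k₀, hk₀⟩ := ((he.exists_tail_le (ε := 1 / 8) (by norm_num)).and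
    (eventually_forall_ge_atTop.2 h1)).exists
  obtain ⟨htail, hta⟩ := hk₀
  have hsmall : ∀ n, |∑ k ∈ range n, t (k₀ + k) * (e (k₀ + k) / D (k₀ + k))| ≤ 1 / 8 := by
    intro n
    have := htail k₀ le_rfl (k₀ + n) (by omega) (by omega)
    rwa [sum_Ico_eq_sum_range, Nat.add_sub_cancel_left, Real.norm_eq_abs] at this
  have hs : ∀ n, |∑ k ∈ range n, t (k₀ + k) * e (k₀ + k)| ≤ D (k₀ + n) / 4 := by
    intro n
    have := abs_sum_mul_le_of_monotone (D := fun k => D (k₀ + k))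
      (fun i j hij => hDm (by omega)) (hDpos _).le hsmall n
    have h2 : ∀ k, D (k₀ + k) * (t (k₀ + k) * (e (k₀ + k) / D (k₀ + k))) =
        t (k₀ + k) * e (k₀ + k) := fun k => by
      have := (hDpos (k₀ + k)).ne'
      field_simp
    simp only [h2] at this
    linarith
  -- Without the accumulated perturbation `s`, the recursion forms convex combinations of the old
  -- value and of `s - b / a`, which is at most `B / a + D / 4`.
  have hβ : ∀ n, |α (k₀ + n) + ∑ k ∈ range n, t (k₀ + k) * e (k₀ + k)| ≤
      |α k₀| + B / a + D (k₀ + n) / 4 := by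
    intro n
    induction n with
    | zero =>
      have := hDpos k₀
      simp only [add_zero, range_zero, sum_empty]
      have : 0 ≤ B / a := by positivity
      linarith
    | succ n ih =>
      set s := ∑ k ∈ range n, t (k₀ + k) * e (k₀ + k) with hsdef
      have h3 : α (k₀ + (n + 1)) + ∑ k ∈ range (n + 1), t (k₀ + k) * e (k₀ + k) =
          (1 - a * t (k₀ + n)) * (α (k₀ + n) + s) +
            a * t (k₀ + n) * (s - b (k₀ + n) / a) := by
        rw [sum_range_succ, ← hsdef, ← add_assoc k₀ n 1, hα]
        field_simp
        ring
      have h4 : a * t (k₀ + n) ≤ 1 := by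
        have := hta (k₀ + n) (by omega)
        rw [lt_div_iff₀ ha] at this
        linarith
      have h5 : 0 ≤ a * t (k₀ + n) := mul_nonneg ha.le (ht0 _)
      have h6 : |s - b (k₀ + n) / a| ≤ |α k₀| + B / a + D (k₀ + n) / 4 := by
        have h7 := abs_sub s (b (k₀ + n) / a)
        have h8 : |b (k₀ + n) / a| ≤ B / a := by
          rw [abs_div, abs_of_pos ha]
          exact div_le_div_of_nonneg_right (hb _) ha.le
        linarith [hs n, abs_nonneg (α k₀)]
      have h9 : D (k₀ + n) ≤ D (k₀ + (n + 1)) := hDm (by omega)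
      rw [h3]
      refine (abs_add_le _ _).trans ?_
      rw [abs_mul, abs_mul, abs_of_nonneg h5, abs_of_nonneg (sub_nonneg.2 h4)]
      have h10 := mul_le_mul_of_nonneg_left ih (sub_nonneg.2 h4)
      have h11 := mul_le_mul_of_nonneg_left h6 h5
      linarith
  have hαn : ∀ n, |α (k₀ + n)| ≤ |α k₀| + B / a + D (k₀ + n) / 2 := by
    intro n
    have h3 := abs_sub (α (k₀ + n) + ∑ k ∈ range n, t (k₀ + k) * e (k₀ + k))
      (∑ k ∈ range n, t (k₀ + k) * e (k₀ + k))
    rw [add_sub_cancel_right] at h3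
    linarith [hβ n, hs n]
  have hBa : 0 ≤ B / a := by positivity
  -- The running maximum is at most a constant plus half of itself.
  have hmain : ∀ n, D (k₀ + n) ≤ D k₀ + B / a + D (k₀ + n) / 2 := by
    intro n
    conv_lhs => rw [hD]
    refine partialSups_le _ _ _ fun i hi => ?_
    rcases le_total i k₀ with hik | hik
    · linarith [hαD i, hDm hik, hDpos (k₀ + n)]
    · obtain ⟨j, rfl⟩ := Nat.exists_eq_add_of_le hik
      linarith [hαn j, hDm hi, hαD k₀]
  refine ⟨2 * (D k₀ + B / a), fun k => ?_⟩
  have h1 := hmain k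
  have h2 : D k ≤ D (k₀ + k) := hDm (by omega)
  linarith

/-- A nonnegative sequence that decreases by `d ≥ 0` up to the terms of a convergent series
converges, and the total decrease is finite. -/
theorem summable_and_tendsto_of_perturbed_descent {f d r : ℕ → ℝ}
    (hf : ∀ k, 0 ≤ f k) (hd : ∀ k, 0 ≤ d k) (hr : SeriesConverges r)
    (hstep : ∀ k, f (k + 1) = f k - d k + r k) :
    Summable d ∧ ∃ c, Tendsto f atTop (𝓝 c) := by
  obtain ⟨s, hs⟩ := hr
  have hsum : ∀ n, f n = f 0 - ∑ k ∈ range n, d k + ∑ k ∈ range n, r k := by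
    intro n
    induction n with
    | zero => simp
    | succ n ih => rw [hstep, ih, sum_range_succ, sum_range_succ]; ring
  obtain ⟨C, hC⟩ := hs.bddAbove_range
  have hdsum : Summable d := by
    refine summable_of_sum_range_le (c := f 0 + C) hd fun n => ?_
    have h1 : ∑ k ∈ range n, r k ≤ C := hC ⟨n, rfl⟩
    linarith [hsum n, hf n]
  refine ⟨hdsum, f 0 - ∑' k, d k + s, ?_⟩
  exact ((tendsto_const_nhds.sub hdsum.hasSum.tendsto_sum_nat).add hs).congr
    fun n => (hsum n).symm

/-- If `z` follows the steps `-t g` up to a convergent series, `g` is a Lipschitz function of `z`,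
`∑ t ‖g‖² < ∞` and `∑ t = ∞`, then `g → 0`: between a time with `‖g‖ < ε` and a later one with
`‖g‖ > 2 ε` the sequence `z` would have to travel a fixed distance, but the length of such an
excursion is at most `ε⁻¹ ∑ t ‖g‖²` up to a small error. -/
theorem tendsto_zero_of_summable_sq {V : Type*} [NormedAddCommGroup V] [NormedSpace ℝ V]
    {z g v : ℕ → V} {t : ℕ → ℝ} {L : ℝ} (hL : 0 < L) (ht0 : ∀ k, 0 ≤ t k)
    (ht : Tendsto t atTop (𝓝 0)) (hts : ¬ Summable t)
    (hstep : ∀ k, z (k + 1) = z k - t k • g k + v k) (hv : SeriesConverges v)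
    (hg : ∀ i j, ‖g i - g j‖ ≤ L * ‖z i - z j‖) (hsum : Summable fun k => t k * ‖g k‖ ^ 2) :
    Tendsto g atTop (𝓝 0) := by
  rw [tendsto_zero_iff_norm_tendsto_zero, Metric.tendsto_atTop]
  intro ε' hε'
  obtain ⟨ε, hε, rfl⟩ : ∃ ε, 0 < ε ∧ ε' = 2 * ε := ⟨ε' / 2, by linarith, by ring⟩
  obtain ⟨δ, hδ, hLδ⟩ : ∃ δ, 0 < δ ∧ L * (3 * δ) < ε := by
    refine ⟨ε / (4 * L), by positivity, ?_⟩
    have : L * (3 * (ε / (4 * L))) = 3 / 4 * ε := by field_simp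
    linarith
  have h1 : ∀ᶠ k in atTop, t k < δ / ε := ht.eventually (gt_mem_nhds (by positivity))
  obtain ⟨k₀, ⟨hvt, hqt⟩, htt⟩ := (((hv.exists_tail_le hδ).and
    (hsum.seriesConverges.exists_tail_le (mul_pos hε hδ))).and
    (eventually_forall_ge_atTop.2 h1)).exists
  obtain ⟨k₁, hk₁, hgk₁⟩ : ∃ k₁ ≥ k₀, ‖g k₁‖ < ε := by
    by_contra! hcon
    apply hts
    rw [← summable_nat_add_iff k₀] at hsum ⊢
    refine Summable.of_nonneg_of_le (fun k => ht0 _) (fun k => ?_) (hsum.mul_left (ε ^ 2)⁻¹)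
    have h2 : ε ^ 2 ≤ ‖g (k + k₀)‖ ^ 2 := by
      gcongr
      exact hcon _ (by omega)
    rw [inv_mul_eq_div, le_div_iff₀ (by positivity)]
    exact mul_le_mul_of_nonneg_left h2 (ht0 _)
  -- The last time `j ≤ n` at which the norm of `g` is less than `ε`.
  have hlast : ∀ n ≥ k₁, ∃ j, k₀ ≤ j ∧ j ≤ n ∧ ‖g j‖ < ε ∧ ∀ i, j < i → i ≤ n → ε ≤ ‖g i‖ := by
    intro n hn
    induction n, hn using Nat.le_induction with
    | base => exact ⟨k₁, hk₁, le_rfl, hgk₁, fun i h h' => by omega⟩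
    | succ n hn ih =>
      by_cases hlt : ‖g (n + 1)‖ < ε
      · exact ⟨n + 1, by omega, le_rfl, hlt, fun i h h' => by omega⟩
      · obtain ⟨j, hj0, hjn, hgj, hj⟩ := ih
        refine ⟨j, hj0, by omega, hgj, fun i hi hin => ?_⟩
        rcases Nat.lt_or_ge n i with h | h
        · obtain rfl : i = n + 1 := by omega
          exact not_lt.1 hlt
        · exact hj i hi h
  refine ⟨k₁, fun n hn => ?_⟩
  obtain ⟨j, hj0, hjn, hgj, hj⟩ := hlast n hn
  have hz : ∀ n, j ≤ n → z n - z j = -∑ i ∈ Ico j n, t i • g i + ∑ i ∈ Ico j n, v i := by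
    intro n hn
    induction n, hn using Nat.le_induction with
    | base => simp
    | succ n hn ih =>
      rw [sum_Ico_succ_top hn, sum_Ico_succ_top hn, hstep]
      calc _ = (z n - z j) - t n • g n + v n := by abel
        _ = _ := by rw [ih]; abel
  have hgsum : ‖∑ i ∈ Ico j n, t i • g i‖ ≤ 2 * δ := by
    have h2 : ∀ i ∈ Ico j n, ‖t i • g i‖ ≤ t i * ‖g i‖ ^ 2 / ε + if i = j then δ else 0 := by
      intro i hi
      rw [norm_smul, Real.norm_of_nonneg (ht0 i)]
      split_ifs with hij
      · subst hij
        have h3 : t i * ‖g i‖ ≤ δ / ε * ε :=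
          mul_le_mul (htt i hj0).le hgj.le (norm_nonneg _) (by positivity)
        rw [div_mul_cancel₀ _ hε.ne'] at h3
        have h4 : 0 ≤ t i * ‖g i‖ ^ 2 / ε := by have := ht0 i; positivity
        linarith
      · rw [mem_Ico] at hi
        have h3 := hj i (by omega) (by omega)
        rw [add_zero, le_div_iff₀ hε, sq, ← mul_assoc]
        exact mul_le_mul_of_nonneg_left h3 (mul_nonneg (ht0 i) (norm_nonneg _))
    refine (norm_sum_le_of_le _ h2).trans ?_
    rw [sum_add_distrib, sum_ite_eq', ← sum_div]
    have h3 := (le_abs_self _).trans (hqt j hj0 n (hj0.trans hjn) hjn)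
    have h4 : (∑ i ∈ Ico j n, t i * ‖g i‖ ^ 2) / ε ≤ δ := by
      rw [div_le_iff₀ hε]; linarith
    split_ifs <;> linarith
  have hzn : ‖z n - z j‖ ≤ 3 * δ := by
    rw [hz n hjn]
    refine (norm_add_le _ _).trans ?_
    rw [norm_neg]
    linarith [hvt j hj0 n (hj0.trans hjn) hjn]
  have h5 : ‖g n‖ ≤ ‖g n - g j‖ + ‖g j‖ := by
    simpa using norm_add_le (g n - g j) (g j)
  have h6 := (hg n j).trans (mul_le_mul_of_nonneg_left hzn hL.le)
  rw [Real.dist_eq, sub_zero, abs_of_nonneg (norm_nonneg _)]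
  linarith

end UMSVRG

/-! ### A martingale convergence theorem for functions of finite samples -/

namespace UMSVRG

section Martingale

variable {ι : Type*} [Fintype ι] [MeasurableSpace ι] [MeasurableSingletonClass ι]
  {Ω : Type*} [mΩ : MeasurableSpace Ω] {μ : Measure Ω} {I : ℕ → Ω → ι}

/-- A function of the first `k` samples factors through the finite tuple of these samples. As the
samples take finitely many values, such a function is bounded and measurable for free. -/
theorem exists_eq_comp_of_dependsOn {ι β : Type*} [Nonempty β] {f : (ℕ → ι) → β} {k : ℕ}
    (hf : DependsOn f (Set.Iio k)) :
    ∃ g : ((range k) → ι) → β, ∀ s, f s = g (fun j => s j) := by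
  refine ⟨Function.extend (fun s (j : range k) => s j) f (fun _ => Classical.arbitrary β),
    fun s => ?_⟩
  have h1 : Function.FactorsThrough f fun s (j : range k) => s j := fun s s' h =>
    hf fun j hj => congrFun h ⟨j, mem_range.2 hj⟩
  exact (h1.extend_apply _ s).symm

/-- The σ-algebra number `k` is generated by the samples with numbers less than `k`. -/
def historyFiltration (hI : ∀ k, Measurable (I k)) : Filtration ℕ mΩ where
  seq k := MeasurableSpace.comap (fun ω (j : range k) => I j ω) MeasurableSpace.pi
  mono' k l hkl := by
    have h1 : (fun ω (j : range k) => I j ω) =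
        (fun (v : range l → ι) (j : range k) =>
          v ⟨j, mem_range.2 ((mem_range.1 j.2).trans_le hkl)⟩) ∘
          fun ω (j : range l) => I j ω := rfl
    beta_reduce
    rw [h1, ← MeasurableSpace.comap_comp]
    exact MeasurableSpace.comap_mono
      (Measurable.comap_le (measurable_pi_lambda _ fun j => measurable_pi_apply _))
  le' k := Measurable.comap_le (measurable_pi_lambda _ fun j => hI j)

theorem measurable_of_dependsOn (hI : ∀ k, Measurable (I k)) {f : (ℕ → ι) → ℝ} {k : ℕ}
    (hf : DependsOn f (Set.Iio k)) :
    Measurable[historyFiltration hI k] fun ω => f (fun j => I j ω) := by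
  obtain ⟨g, hg⟩ := exists_eq_comp_of_dependsOn hf
  simp only [hg]
  exact @Measurable.comp _ _ _ (_) _ _ g _ (measurable_of_finite g) (comap_measurable _)

theorem exists_abs_le_of_dependsOn {ι : Type*} [Finite ι] {f : (ℕ → ι) → ℝ} {k : ℕ}
    (hf : DependsOn f (Set.Iio k)) : ∃ C, ∀ s, |f s| ≤ C := by
  obtain ⟨g, hg⟩ := exists_eq_comp_of_dependsOn hf
  obtain ⟨C, hC⟩ := (Set.finite_range fun v => |g v|).bddAbove
  exact ⟨C, fun s => by rw [hg]; exact hC ⟨_, rfl⟩⟩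

variable [IsProbabilityMeasure μ]

theorem memLp_of_dependsOn (hI : ∀ k, Measurable (I k)) {f : (ℕ → ι) → ℝ} {k : ℕ}
    (hf : DependsOn f (Set.Iio k)) (p : ENNReal) : MemLp (fun ω => f (fun j => I j ω)) p μ := by
  obtain ⟨C, hC⟩ := exists_abs_le_of_dependsOn hf
  refine MemLp.of_bound ?_ C (ae_of_all _ fun ω => hC _)
  exact ((measurable_of_dependsOn hI hf).mono ((historyFiltration hI).le k)
    le_rfl).aestronglyMeasurable

/-- A function of the history and of the next sample, centred in the next sample, is orthogonal to
every function of the history. -/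
theorem integral_mul_eq_zero_of_centred (hI : ∀ k, Measurable (I k)) (hind : iIndepFun I μ)
    {k : ℕ} {V : (ℕ → ι) → ℝ} (hV : DependsOn V (Set.Iio k))
    {φ : (ℕ → ι) → ι → ℝ} (hφ : ∀ j, DependsOn (fun s => φ s j) (Set.Iio k))
    (h0 : ∀ s, ∑ j, μ.real {ω | I k ω = j} * φ s j = 0) :
    ∫ ω, V (fun j => I j ω) * φ (fun j => I j ω) (I k ω) ∂μ = 0 := by
  classical
  have hset : ∀ j, MeasurableSet {ω | I k ω = j} := fun j => hI k (measurableSet_singleton j)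
  have hW : ∀ j, DependsOn (fun s => V s * φ s j) (Set.Iio k) := fun j s s' h => by
    change V s * φ s j = V s' * φ s' j
    rw [hV h]
    exact congrArg _ (hφ j h)
  have hsplit : ∀ ω, V (fun j => I j ω) * φ (fun j => I j ω) (I k ω) =
      ∑ j, (V (fun j => I j ω) * φ (fun j => I j ω) j) * (if I k ω = j then 1 else 0) := by
    intro ω; simp
  have hone : ∀ j, ∫ ω, (V (fun j => I j ω) * φ (fun j => I j ω) j) *
      (if I k ω = j then (1 : ℝ) else 0) ∂μ =
      (∫ ω, V (fun j => I j ω) * φ (fun j => I j ω) j ∂μ) * μ.real {ω | I k ω = j} := by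
    intro j
    obtain ⟨g, hg⟩ := exists_eq_comp_of_dependsOn (hW j)
    have h1 := hind.indepFun_finset (range k) {k} (by simp) hI
    have h2 := h1.comp (φ := g)
      (ψ := fun v : (({k} : Finset ℕ) → ι) => if v ⟨k, by simp⟩ = j then (1 : ℝ) else 0)
      (measurable_of_finite _) (measurable_of_finite _)
    have h3 := h2.integral_mul_eq_mul_integral
      ((measurable_of_finite g).comp
        (measurable_pi_lambda _ fun j : range k => hI j)).aestronglyMeasurable
      ((measurable_of_finite _).comp
        (measurable_pi_lambda _ fun j : ({k} : Finset ℕ) => hI j)).aestronglyMeasurable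
    have h4 : ∫ ω, (if I k ω = j then (1 : ℝ) else 0) ∂μ = μ.real {ω | I k ω = j} := by
      rw [← integral_indicator_one (hset j)]
      rfl
    simp only [Function.comp_def, Pi.mul_def] at h3
    have h5 : ∀ ω, V (fun j => I j ω) * φ (fun j => I j ω) j = g fun j => I j ω := fun ω => hg _
    simp only [h5]
    rw [h3, h4]
  have hint : ∀ j, Integrable (fun ω => V (fun j => I j ω) * φ (fun j => I j ω) j) μ :=
    fun j => (memLp_of_dependsOn hI (hW j) 1).integrable le_rfl
  simp only [hsplit]
  rw [integral_finsetSum]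
  · simp only [hone]
    simp_rw [← integral_mul_const]
    rw [← integral_finsetSum _ fun j _ => (hint j).mul_const _]
    refine integral_eq_zero_of_ae (ae_of_all _ fun ω => ?_)
    change ∑ j, V (fun j => I j ω) * φ (fun j => I j ω) j * μ.real {ω | I k ω = j} = 0
    calc _ = V (fun j => I j ω) * ∑ j, μ.real {ω | I k ω = j} * φ (fun j => I j ω) j := by
          rw [mul_sum]; exact sum_congr rfl fun j _ => by ring
      _ = 0 := by rw [h0, mul_zero]
  · intro j _
    refine (hint j).mul_bdd (c := 1) ?_ (ae_of_all _ fun ω => ?_)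
    · exact ((measurable_of_finite fun i : ι => if i = j then (1 : ℝ) else 0).comp
        (hI k)).aestronglyMeasurable
    · split_ifs <;> simp

/-- Martingale convergence: bounded functions `φ k` of the history and of the sample number `k`,
centred in that sample, have an almost surely convergent series `∑ t k * φ k` when the step sizes
are square summable. -/
theorem ae_seriesConverges_real (hI : ∀ k, Measurable (I k)) (hind : iIndepFun I μ)
    {φ : ℕ → (ℕ → ι) → ι → ℝ} (hφ : ∀ k j, DependsOn (fun s => φ k s j) (Set.Iio k))
    {C : ℝ} (hC : ∀ k s j, |φ k s j| ≤ C)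
    (h0 : ∀ k s, ∑ j, μ.real {ω | I k ω = j} * φ k s j = 0)
    {t : ℕ → ℝ} (ht : Summable fun k => t k ^ 2) :
    ∀ᵐ ω ∂μ, SeriesConverges fun k => t k * φ k (fun j => I j ω) (I k ω) := by
  set S : ℕ → (ℕ → ι) → ℝ := fun n s => ∑ k ∈ range n, t k * φ k s (s k) with hS
  have hSd : ∀ n, DependsOn (S n) (Set.Iio n) := fun n s s' h =>
    sum_congr rfl fun k hk => by
      have hk' := mem_range.1 hk
      rw [h k hk']
      exact congrArg _ (hφ k _ fun j hj => h j (lt_trans hj hk'))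
  have hmem : ∀ n p, MemLp (fun ω => S n fun j => I j ω) p μ := fun n p =>
    memLp_of_dependsOn hI (hSd n) p
  have hinc : ∀ n, DependsOn (fun s : ℕ → ι => t n * φ n s (s n)) (Set.Iio (n + 1)) :=
    fun n s s' h => by
      change t n * φ n s (s n) = t n * φ n s' (s' n)
      rw [h n (Nat.lt_succ_self n)]
      exact congrArg _ (hφ n _ fun j hj => h j (Nat.lt_succ_of_lt hj))
  have horth : ∀ n (V : (ℕ → ι) → ℝ), DependsOn V (Set.Iio n) →
      ∫ ω, V (fun j => I j ω) * (t n * φ n (fun j => I j ω) (I n ω)) ∂μ = 0 := by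
    intro n V hV
    have := integral_mul_eq_zero_of_centred hI hind hV (hφ n) (h0 n)
    have h1 : ∀ ω, V (fun j => I j ω) * (t n * φ n (fun j => I j ω) (I n ω)) =
        t n * (V (fun j => I j ω) * φ n (fun j => I j ω) (I n ω)) := fun ω => by ring
    simp only [h1]
    rw [integral_const_mul, this, mul_zero]
  have hmart : Martingale (fun n ω => S n fun j => I j ω) (historyFiltration hI) μ := by
    refine martingale_of_setIntegral_eq_succ
      (fun n => (measurable_of_dependsOn hI (hSd n)).stronglyMeasurable)
      (fun n => (hmem n 1).integrable le_rfl) fun n s hs => ?_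
    have hms := (historyFiltration hI).le n s hs
    obtain ⟨A, -, hA⟩ := hs
    have h1 := horth n (fun s => A.indicator (fun _ => (1 : ℝ)) fun j : range n => s j)
      fun s s' h => by
        change A.indicator (fun _ => (1 : ℝ)) _ = A.indicator (fun _ => (1 : ℝ)) _
        congr 1
        exact funext fun j => h j (mem_range.1 j.2)
    have h2 : ∀ ω, S (n + 1) (fun j => I j ω) =
        S n (fun j => I j ω) + t n * φ n (fun j => I j ω) (I n ω) := fun ω =>
      sum_range_succ _ _
    simp only [h2]
    rw [integral_add ((hmem n 1).integrable le_rfl).integrableOn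
      (((memLp_of_dependsOn hI (hinc n) 1).integrable le_rfl).integrableOn)]
    rw [left_eq_add, ← integral_indicator hms, ← h1]
    refine integral_congr_ae (ae_of_all _ fun ω => ?_)
    by_cases hω : ω ∈ s
    · have : (fun j : range n => I j ω) ∈ A := by rw [← hA] at hω; exact hω
      simp [hω, this]
    · have : (fun j : range n => I j ω) ∉ A := by rw [← hA] at hω; exact hω
      simp [hω, this]
  have hC0 : ∀ k s j, (t k * φ k s j) ^ 2 ≤ C ^ 2 * t k ^ 2 := fun k s j => by
    rw [mul_pow, mul_comm]
    gcongr ?_ * _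
    exact sq_le_sq' (abs_le.1 (hC k s j)).1 (abs_le.1 (hC k s j)).2
  have hsq : ∀ n, ∫ ω, (S n fun j => I j ω) ^ 2 ∂μ ≤ C ^ 2 * ∑ k ∈ range n, t k ^ 2 := by
    intro n
    induction n with
    | zero => simp [hS]
    | succ n ih =>
      have h2 : ∀ ω, (S (n + 1) fun j => I j ω) ^ 2 =
          (S n fun j => I j ω) ^ 2 +
            2 * ((S n fun j => I j ω) * (t n * φ n (fun j => I j ω) (I n ω))) +
            (t n * φ n (fun j => I j ω) (I n ω)) ^ 2 := fun ω => by
        simp only [hS, sum_range_succ]; ring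
      have hi1 := (hmem n 2).integrable_sq
      have hi3 : Integrable (fun ω => (t n * φ n (fun j => I j ω) (I n ω)) ^ 2) μ :=
        (memLp_of_dependsOn hI (hinc n) 2 (μ := μ)).integrable_sq
      have hi2 : Integrable (fun ω => 2 * ((S n fun j => I j ω) *
          (t n * φ n (fun j => I j ω) (I n ω)))) μ :=
        ((hmem n 2).integrable_mul (memLp_of_dependsOn hI (hinc n) 2)).const_mul 2
      simp only [h2]
      rw [integral_add (by exact hi1.add hi2) hi3, integral_add hi1 hi2, integral_const_mul,
        horth n _ (hSd n), sum_range_succ, mul_add]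
      have h3 : ∫ ω, (t n * φ n (fun j => I j ω) (I n ω)) ^ 2 ∂μ ≤ ∫ _, C ^ 2 * t n ^ 2 ∂μ :=
        integral_mono hi3 (integrable_const _) fun ω => hC0 n _ _
      rw [integral_const, probReal_univ, one_smul] at h3
      linarith
  have hbdd : ∀ n, eLpNorm (fun ω => S n fun j => I j ω) 1 μ ≤
      ((1 + C ^ 2 * ∑' k, t k ^ 2).toNNReal : ENNReal) := by
    intro n
    rw [eLpNorm_one_eq_lintegral_enorm, ← ofReal_integral_norm_eq_lintegral_enorm
      ((hmem n 1).integrable le_rfl)]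
    refine ENNReal.ofReal_le_ofReal ?_
    have h1 : ∫ ω, ‖S n fun j => I j ω‖ ∂μ ≤ ∫ ω, 1 + (S n fun j => I j ω) ^ 2 ∂μ := by
      refine integral_mono ((hmem n 1).integrable le_rfl).norm
        ((integrable_const _).add (hmem n 2).integrable_sq) fun ω => ?_
      change |S n fun j => I j ω| ≤ 1 + (S n fun j => I j ω) ^ 2
      nlinarith [sq_abs (S n fun j => I j ω), sq_nonneg (|S n fun j => I j ω| - 1),
        abs_nonneg (S n fun j => I j ω)]
    rw [integral_add (integrable_const _) (hmem n 2).integrable_sq, integral_const,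
      probReal_univ, one_smul] at h1
    have h2 : ∑ k ∈ range n, t k ^ 2 ≤ ∑' k, t k ^ 2 :=
      ht.sum_le_tsum _ fun k _ => sq_nonneg _
    have h3 := mul_le_mul_of_nonneg_left h2 (sq_nonneg C)
    linarith [hsq n]
  exact hmart.submartingale.exists_ae_tendsto_of_bdd hbdd

/-- The vector-valued form of `ae_seriesConverges_real`. -/
theorem ae_seriesConverges (hI : ∀ k, Measurable (I k)) (hind : iIndepFun I μ)
    {V : Type*} [NormedAddCommGroup V] [NormedSpace ℝ V] [FiniteDimensional ℝ V]
    {φ : ℕ → (ℕ → ι) → ι → V} (hφ : ∀ k j, DependsOn (fun s => φ k s j) (Set.Iio k))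
    {C : ℝ} (hC : ∀ k s j, ‖φ k s j‖ ≤ C)
    (h0 : ∀ k s, ∑ j, μ.real {ω | I k ω = j} • φ k s j = 0)
    {t : ℕ → ℝ} (ht : Summable fun k => t k ^ 2) :
    ∀ᵐ ω ∂μ, SeriesConverges fun k => t k • φ k (fun j => I j ω) (I k ω) := by
  set b := Module.finBasis ℝ V
  have hcoord : ∀ d, ∀ᵐ ω ∂μ,
      SeriesConverges fun k => t k * b.coord d (φ k (fun j => I j ω) (I k ω)) := by
    intro d
    set ℓ : V →L[ℝ] ℝ := (b.coord d).toContinuousLinearMap with hℓ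
    refine ae_seriesConverges_real hI hind (φ := fun k s j => b.coord d (φ k s j))
      (fun k j s s' h => congrArg _ (hφ k j h)) (C := ‖ℓ‖ * C) (fun k s j => ?_)
      (fun k s => ?_) ht
    · exact (ℓ.le_opNorm _).trans (mul_le_mul_of_nonneg_left (hC k s j) (norm_nonneg _))
    · have := congrArg (b.coord d) (h0 k s)
      simpa only [map_sum, map_smul, smul_eq_mul, map_zero] using this
  filter_upwards [ae_all_iff.2 hcoord] with ω hω
  choose l hl using hω
  refine ⟨∑ d, l d • b d, ?_⟩
  have h1 := tendsto_finsetSum univ fun d _ => (hl d).smul_const (b d)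
  refine h1.congr fun n => ?_
  simp_rw [sum_smul]
  rw [sum_comm]
  refine sum_congr rfl fun k _ => ?_
  conv_rhs => rw [← b.sum_repr (φ k (fun j => I j ω) (I k ω)), smul_sum]
  simp only [Module.Basis.coord_apply, mul_smul]

end Martingale

end UMSVRG

/-! ### The geometry of `ℝ × UM(N, M)` -/

namespace UMSVRG

variable {N M : ℕ}

theorem tproj_add (X Z W : Wave N M) : tproj X (Z + W) = tproj X Z + tproj X W := by
  ext p
  simp only [tproj, PiLp.add_apply, add_mul, Complex.add_re, Complex.ofReal_add]
  ring

theorem tproj_smul (X Z : Wave N M) (c : ℝ) : tproj X (c • Z) = c • tproj X Z := by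
  ext p
  simp only [tproj, PiLp.smul_apply, Complex.real_smul, mul_assoc, Complex.re_ofReal_mul,
    Complex.ofReal_mul]
  ring

theorem tproj_eq_self {X ξ : Wave N M} (hξ : ξ ∈ tangent X) : tproj X ξ = ξ := by
  ext p
  change ξ p - ((ξ p * conj (X p)).re : ℂ) * X p = ξ p
  rw [hξ p, Complex.ofReal_zero, zero_mul, sub_zero]

theorem inner_tproj {X ξ : Wave N M} (hξ : ξ ∈ tangent X) (Z : Wave N M) :
    inner ℝ (tproj X Z) ξ = inner ℝ Z ξ := by
  have h := inner_sub_tproj X Z ξ hξ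
  rw [inner_sub_right, sub_eq_zero] at h
  rw [real_inner_comm, ← h, real_inner_comm]

theorem norm_tproj_le {X : Wave N M} (hX : X ∈ UM N M) (Z : Wave N M) :
    ‖tproj X Z‖ ≤ ‖Z‖ := by
  have h := inner_tproj (tproj_mem_tangent hX Z) Z
  rw [real_inner_self_eq_norm_sq] at h
  have h1 := real_inner_le_norm Z (tproj X Z)
  rcases (norm_nonneg (tproj X Z)).eq_or_lt with h0 | h0
  · rw [← h0]; exact norm_nonneg _
  · exact le_of_mul_le_mul_right (by nlinarith) h0

theorem contDiff_tproj {n : WithTop ℕ∞} {E : Type*} [NormedAddCommGroup E] [NormedSpace ℝ E]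
    {f g : E → Wave N M} (hf : ContDiff ℝ n f) (hg : ContDiff ℝ n g) :
    ContDiff ℝ n fun x => tproj (f x) (g x) := by
  rw [contDiff_piLp]
  intro p
  have h1 : ContDiff ℝ n fun x => f x p := (contDiff_piLp _).1 hf p
  have h2 : ContDiff ℝ n fun x => g x p := (contDiff_piLp _).1 hg p
  have h3 : ContDiff ℝ n fun x => conj (f x p) := Complex.conjCLE.contDiff.comp h1
  exact h2.sub ((Complex.ofRealCLM.contDiff.comp (Complex.reCLM.contDiff.comp (h2.mul h3))).mul h1)

/-- The Riemannian metric of the product `ℝ × ℂ^{N × M}`. -/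
noncomputable def metric (u v : Pt N M) : ℝ := u.1 * v.1 + inner ℝ u.2 v.2

theorem metric_add_right (u v w : Pt N M) : metric u (v + w) = metric u v + metric u w := by
  simp only [metric, Prod.fst_add, Prod.snd_add, inner_add_right]; ring

theorem metric_smul_right (u v : Pt N M) (c : ℝ) : metric u (c • v) = c * metric u v := by
  simp only [metric, Prod.smul_fst, Prod.smul_snd, inner_smul_right, smul_eq_mul]; ring

theorem abs_metric_le (u v : Pt N M) : |metric u v| ≤ 2 * ‖u‖ * ‖v‖ := by
  have h1 : |u.1 * v.1| ≤ ‖u‖ * ‖v‖ := by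
    rw [abs_mul]
    exact mul_le_mul (norm_fst_le u) (norm_fst_le v) (abs_nonneg _) (norm_nonneg _)
  have h2 : |inner ℝ u.2 v.2| ≤ ‖u‖ * ‖v‖ := (abs_real_inner_le_norm _ _).trans
    (mul_le_mul (norm_snd_le u) (norm_snd_le v) (norm_nonneg _) (norm_nonneg _))
  have h3 := abs_add_le (u.1 * v.1) (inner ℝ u.2 v.2)
  unfold metric
  linarith

theorem sq_norm_le_metric (u : Pt N M) : ‖u‖ ^ 2 ≤ metric u u := by
  rw [metric, real_inner_self_eq_norm_sq, Prod.norm_def]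
  rcases max_choice ‖u.1‖ ‖u.2‖ with h | h <;> rw [h]
  · rw [Real.norm_eq_abs, sq_abs]; nlinarith [sq_nonneg ‖u.2‖]
  · nlinarith [mul_self_nonneg u.1]

/-- `metric u` as a linear map. -/
noncomputable def metricL (u : Pt N M) : Pt N M →ₗ[ℝ] ℝ where
  toFun := metric u
  map_add' := metric_add_right u
  map_smul' c v := metric_smul_right u v c

theorem norm_transport_le {x : Pt N M} (hx : x ∈ manifold N M) (ξ : Pt N M) :
    ‖transport x ξ‖ ≤ ‖ξ‖ :=
  max_le_max le_rfl (norm_tproj_le hx ξ.2)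

/-- `transport x` as a linear map. -/
noncomputable def transportL (x : Pt N M) : Pt N M →ₗ[ℝ] Pt N M where
  toFun := transport x
  map_add' _ _ := Prod.ext rfl (tproj_add _ _ _)
  map_smul' c _ := Prod.ext rfl (tproj_smul _ _ c)

/-! #### The retraction -/

/-- A tangent step `v` at a point `u` of the unit circle leads outside of the open unit disc, and
its radial excess is of second order. -/
theorem norm_add_of_tangent {u v : ℂ} (hu : ‖u‖ = 1) (hv : (v * conj u).re = 0) :
    1 ≤ ‖u + v‖ ∧ ‖u + v‖ - 1 ≤ ‖v‖ ∧ ‖u + v‖ - 1 ≤ ‖v‖ ^ 2 := by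
  have h1 : ‖u + v‖ ^ 2 = 1 + ‖v‖ ^ 2 := by
    have h2 : u.re * u.re + u.im * u.im = 1 := by
      have := Complex.normSq_eq_norm_sq u
      rw [hu, Complex.normSq_apply] at this
      simpa using this
    rw [← Complex.normSq_eq_norm_sq, ← Complex.normSq_eq_norm_sq, Complex.normSq_apply,
      Complex.normSq_apply]
    simp only [Complex.mul_re, Complex.conj_re, Complex.conj_im] at hv
    simp only [Complex.add_re, Complex.add_im]
    linear_combination h2 + 2 * hv
  have h3 : 1 ≤ ‖u + v‖ := by
    by_contra! h
    nlinarith [norm_nonneg (u + v), sq_nonneg ‖v‖]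
  refine ⟨h3, ?_, ?_⟩
  · have := norm_add_le u v
    linarith
  · nlinarith

/-- The retraction agrees with `x + ξ` up to a quadratic error: the correction is radial in each
entry. -/
theorem exists_retract_eq {x ξ : Pt N M} (hx : x ∈ manifold N M) (hξ : ξ.2 ∈ tangent x.2) :
    ∃ ρ : Pt N M, retract x ξ = x + ξ + ρ ∧ ‖ρ‖ ≤ ‖ξ‖ ∧ ‖ρ‖ ≤ ‖ξ‖ ^ 2 := by
  have hp : ∀ p, ‖(retract x ξ - (x + ξ)).2 p‖ = ‖x.2 p + ξ.2 p‖ - 1 := by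
    intro p
    have h1 := (norm_add_of_tangent (hx p) (hξ p)).1
    set u := x.2 p + ξ.2 p with hu
    have h2 : (retract x ξ - (x + ξ)).2 p = u / (‖u‖ : ℂ) - u := rfl
    have h3 : u / (‖u‖ : ℂ) - u = u / (‖u‖ : ℂ) * ((1 - ‖u‖ : ℝ) : ℂ) := by
      have : (‖u‖ : ℂ) ≠ 0 := by
        rw [Ne, Complex.ofReal_eq_zero]; linarith
      push_cast
      field_simp
    rw [h2, h3, norm_mul, norm_div, Complex.norm_real, norm_norm, div_self (by linarith), one_mul,
      Complex.norm_real, Real.norm_eq_abs, abs_of_nonpos (by linarith)]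
    ring
  have hfst : (retract x ξ - (x + ξ)).1 = 0 := by simp [retract]
  have hnorm : ‖retract x ξ - (x + ξ)‖ = ‖(retract x ξ - (x + ξ)).2‖ := by
    rw [Prod.norm_def, hfst, norm_zero, max_eq_right (norm_nonneg _)]
  have hle : ‖ξ.2‖ ≤ ‖ξ‖ := norm_snd_le ξ
  refine ⟨retract x ξ - (x + ξ), by abel, ?_, ?_⟩
  · rw [hnorm]
    refine le_trans ?_ hle
    rw [EuclideanSpace.norm_eq, EuclideanSpace.norm_eq]
    refine Real.sqrt_le_sqrt (sum_le_sum fun p _ => ?_)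
    have h1 := norm_add_of_tangent (hx p) (hξ p)
    rw [hp]
    exact pow_le_pow_left₀ (by linarith) h1.2.1 2
  · rw [hnorm]
    refine le_trans ?_ (pow_le_pow_left₀ (norm_nonneg _) hle 2)
    have h1 : ‖(retract x ξ - (x + ξ)).2‖ ≤ ∑ p, ‖(retract x ξ - (x + ξ)).2 p‖ := by
      rw [EuclideanSpace.norm_eq, Real.sqrt_le_left (sum_nonneg fun p _ => norm_nonneg _)]
      exact sum_sq_le_sq_sum_of_nonneg fun p _ => norm_nonneg _
    refine h1.trans ?_
    rw [EuclideanSpace.norm_sq_eq]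
    refine sum_le_sum fun p _ => ?_
    rw [hp]
    exact (norm_add_of_tangent (hx p) (hξ p)).2.2

theorem retract_mem_manifold {x ξ : Pt N M} (hx : x ∈ manifold N M) (hξ : ξ.2 ∈ tangent x.2) :
    retract x ξ ∈ manifold N M := by
  intro p
  have h1 := (norm_add_of_tangent (hx p) (hξ p)).1
  change ‖(x.2 p + ξ.2 p) / (‖x.2 p + ξ.2 p‖ : ℂ)‖ = 1
  rw [norm_div, Complex.norm_real, norm_norm, div_self (by linarith)]

theorem norm_retract_sub_le {x ξ : Pt N M} (hx : x ∈ manifold N M) (hξ : ξ.2 ∈ tangent x.2) :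
    ‖retract x ξ - x‖ ≤ 2 * ‖ξ‖ := by
  obtain ⟨ρ, h, h1, -⟩ := exists_retract_eq hx hξ
  have h2 : retract x ξ - x = ξ + ρ := by rw [h]; abel
  rw [h2]
  linarith [norm_add_le ξ ρ]

/-! #### Compact parts of the manifold -/

theorem isCompact_UM : IsCompact (UM N M) := by
  refine Metric.isCompact_of_isClosed_isBounded ?_ ?_
  · have : UM N M = ⋂ p, {X : Wave N M | ‖X p‖ = 1} := by ext; simp [UM]
    rw [this]
    exact isClosed_iInter fun p => isClosed_eq (by fun_prop) continuous_const
  · refine isBounded_iff_forall_norm_le.2 ⟨∑ _p : Fin N × Fin M, 1, fun X hX => ?_⟩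
    have h1 : ‖X‖ ≤ ∑ p, ‖X p‖ := by
      rw [EuclideanSpace.norm_eq, Real.sqrt_le_left (sum_nonneg fun p _ => norm_nonneg _)]
      exact sum_sq_le_sq_sum_of_nonneg fun p _ => norm_nonneg _
    exact h1.trans (sum_le_sum fun p _ => (hX p).le)

/-- The part of the manifold where `|α| ≤ K`. -/
def slab (N M : ℕ) (K : ℝ) : Set (Pt N M) := Set.Icc (-K) K ×ˢ UM N M

theorem mem_slab {x : Pt N M} {K : ℝ} (hx : x ∈ manifold N M) (hK : |x.1| ≤ K) :
    x ∈ slab N M K := ⟨abs_le.1 hK, hx⟩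

theorem isCompact_slab (K : ℝ) : IsCompact (slab N M K) := isCompact_Icc.prod isCompact_UM

theorem isClosed_manifold : IsClosed (manifold N M) :=
  isCompact_UM.isClosed.preimage continuous_snd

theorem exists_lipschitz_of_contDiff {E F : Type*} [NormedAddCommGroup E] [NormedSpace ℝ E]
    [NormedAddCommGroup F] [NormedSpace ℝ F] {G : E → F} (hG : ContDiff ℝ 1 G) {s : Set E}
    (hs : IsCompact s) : ∃ L, 0 < L ∧ ∀ x ∈ s, ∀ y ∈ s, ‖G x - G y‖ ≤ L * ‖x - y‖ := by
  obtain ⟨L, hL⟩ := LocallyLipschitzOn.exists_lipschitzOnWith_of_compact hs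
    hG.locallyLipschitz.locallyLipschitzOn
  refine ⟨L + 1, by positivity, fun x hx y hy => ?_⟩
  have := hL.norm_sub_le hx hy
  nlinarith [norm_nonneg (x - y)]

/-- The second order remainder of a `C²` function is quadratic, uniformly on compact sets. -/
theorem exists_taylor_bound {E : Type*} [NormedAddCommGroup E] [NormedSpace ℝ E] [ProperSpace E]
    {F : E → ℝ} (hF : ContDiff ℝ 2 F) {s : Set E} (hs : IsCompact s) :
    ∃ C, 0 < C ∧ ∀ x ∈ s, ∀ y ∈ s, |F y - F x - fderiv ℝ F x (y - x)| ≤ C * ‖y - x‖ ^ 2 := by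
  obtain ⟨R, hR⟩ := hs.isBounded.subset_closedBall (0 : E)
  have hd : ContDiff ℝ 1 (fderiv ℝ F) := hF.fderiv_right (by norm_num)
  obtain ⟨L, hL0, hL⟩ := exists_lipschitz_of_contDiff hd (isCompact_closedBall (0 : E) R)
  refine ⟨L, hL0, fun x hx y hy => ?_⟩
  have hseg : segment ℝ x y ⊆ Metric.closedBall (0 : E) R :=
    (convex_closedBall (0 : E) R).segment_subset (hR hx) (hR hy)
  have := Convex.norm_image_sub_le_of_norm_hasFDerivWithin_le' (f := F) (f' := fderiv ℝ F)
    (φ := fderiv ℝ F x) (s := segment ℝ x y) (C := L * ‖y - x‖) (x := x) (y := y)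
    (fun w _ => ((hF.differentiable (by norm_num)) w).hasFDerivAt.hasFDerivWithinAt)
    (fun w hw => (hL w (hseg hw) x (hR hx)).trans
      (mul_le_mul_of_nonneg_left (norm_sub_le_of_mem_segment hw) hL0.le))
    (convex_segment x y) (left_mem_segment ℝ x y) (right_mem_segment ℝ x y)
  rwa [Real.norm_eq_abs, mul_assoc, ← sq] at this

/-! #### Riemannian gradients of smooth functions -/

/-- The Riemannian gradient at `x` that belongs to the derivative `ℓ`. -/
noncomputable def gradOf (x : Pt N M) : (Pt N M →L[ℝ] ℝ) →ₗ[ℝ] Pt N M where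
  toFun ℓ := (ℓ (1, 0), tproj x.2 ((InnerProductSpace.toDual ℝ (Wave N M)).symm
    (ℓ.comp (ContinuousLinearMap.inr ℝ ℝ (Wave N M)))))
  map_add' ℓ ℓ' := by
    rw [ContinuousLinearMap.add_comp, map_add, tproj_add]; rfl
  map_smul' c ℓ := by
    rw [ContinuousLinearMap.smul_comp, map_smulₛₗ, RingHom.id_apply, conj_trivial, tproj_smul]; rfl

theorem grad_eq_gradOf {F : Pt N M → ℝ} {x : Pt N M} (hF : DifferentiableAt ℝ F x) :
    grad F x = gradOf x (fderiv ℝ F x) := by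
  have h1 : HasDerivAt (fun a => F (a, x.2)) (fderiv ℝ F x (1, 0)) x.1 := by
    have := hF.hasFDerivAt.comp_hasDerivAt x.1
      ((hasDerivAt_id x.1).prodMk (hasDerivAt_const x.1 x.2))
    exact this
  have h2 : HasFDerivAt (fun X => F (x.1, X))
      ((fderiv ℝ F x).comp (ContinuousLinearMap.inr ℝ ℝ (Wave N M))) x.2 :=
    HasFDerivAt.comp x.2 (f := fun X => (x.1, X)) (g := F) hF.hasFDerivAt
      (hasFDerivAt_prodMk_right x.1 x.2)
  simp only [grad, gradOf, gradient, h1.deriv, h2.fderiv]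
  rfl

theorem contDiff_grad {F : Pt N M → ℝ} (hF : ContDiff ℝ 2 F) : ContDiff ℝ 1 (grad F) := by
  have hd : ContDiff ℝ 1 (fderiv ℝ F) := hF.fderiv_right (by norm_num)
  have h : grad F = fun x => gradOf x (fderiv ℝ F x) :=
    funext fun x => grad_eq_gradOf ((hF.differentiable (by norm_num)) x)
  rw [h]
  refine ContDiff.prodMk (hd.clm_apply contDiff_const) (contDiff_tproj contDiff_snd ?_)
  exact (InnerProductSpace.toDual ℝ (Wave N M)).symm.contDiff.comp (hd.clm_comp contDiff_const)

theorem grad_mem_tangent (F : Pt N M → ℝ) {x : Pt N M} (hx : x ∈ manifold N M) :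
    (grad F x).2 ∈ tangent x.2 := tproj_mem_tangent hx _

theorem transport_eq_self {x ξ : Pt N M} (hξ : ξ.2 ∈ tangent x.2) : transport x ξ = ξ :=
  Prod.ext rfl (tproj_eq_self hξ)

theorem fderiv_apply_eq_metric {F : Pt N M → ℝ} {x ξ : Pt N M} (hF : DifferentiableAt ℝ F x)
    (hξ : ξ.2 ∈ tangent x.2) : fderiv ℝ F x ξ = metric (grad F x) ξ := by
  have h1 : ξ = ξ.1 • ((1, 0) : Pt N M) + (0, ξ.2) := by ext <;> simp
  rw [grad_eq_gradOf hF]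
  conv_lhs => rw [h1, map_add, map_smul]
  simp only [metric, gradOf, LinearMap.coe_mk, AddHom.coe_mk]
  rw [inner_tproj hξ, InnerProductSpace.toDual_symm_apply, smul_eq_mul, mul_comm]
  rfl

/-- First order expansion of a `C²` function along the retraction. -/
theorem exists_retract_taylor_bound {F : Pt N M → ℝ} (hF : ContDiff ℝ 2 F) (K : ℝ) :
    ∃ C, 0 ≤ C ∧ ∀ x ∈ slab N M K, ∀ ξ : Pt N M, ξ.2 ∈ tangent x.2 → retract x ξ ∈ slab N M K →
      |F (retract x ξ) - F x - metric (grad F x) ξ| ≤ C * ‖ξ‖ ^ 2 := by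
  obtain ⟨C, hC0, hC⟩ := exists_taylor_bound hF (isCompact_slab (N := N) (M := M) K)
  obtain ⟨B, hB⟩ := (isCompact_slab (N := N) (M := M) K).exists_bound_of_continuousOn
    (hF.continuous_fderiv (by norm_num)).continuousOn
  refine ⟨4 * C + |B|, by positivity, fun x hx ξ hξ hy => ?_⟩
  obtain ⟨ρ, h, -, h2⟩ := exists_retract_eq hx.2 hξ
  have h3 := hC x hx _ hy
  have h4 : retract x ξ - x = ξ + ρ := by rw [h]; abel
  have h5 : ‖retract x ξ - x‖ ^ 2 ≤ 4 * ‖ξ‖ ^ 2 := by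
    have := pow_le_pow_left₀ (norm_nonneg _) (norm_retract_sub_le hx.2 hξ) 2
    linarith
  have h6 : |fderiv ℝ F x ρ| ≤ |B| * ‖ξ‖ ^ 2 :=
    ((fderiv ℝ F x).le_opNorm ρ).trans
      (mul_le_mul ((hB x hx).trans (le_abs_self B)) h2 (norm_nonneg _) (abs_nonneg _))
  have h7 : fderiv ℝ F x (retract x ξ - x) = metric (grad F x) ξ + fderiv ℝ F x ρ := by
    rw [h4, map_add, fderiv_apply_eq_metric ((hF.differentiable (by norm_num)) x) hξ]
  rw [h7] at h3
  have h8 : F (retract x ξ) - F x - metric (grad F x) ξ =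
      (F (retract x ξ) - F x - (metric (grad F x) ξ + fderiv ℝ F x ρ)) + fderiv ℝ F x ρ := by ring
  rw [h8]
  refine (abs_add_le _ _).trans ?_
  nlinarith

end UMSVRG

/-! ### The losses and their gradients -/

namespace UMSVRG

variable {N M : ℕ}

/-- The function is a quadratic polynomial in `α` with leading coefficient `a`, the other
coefficients being `C²` functions of `X`. -/
def QuadraticIn (a : ℝ) (F : Pt N M → ℝ) : Prop :=
  ∃ b c : Wave N M → ℝ, ContDiff ℝ 2 b ∧ ContDiff ℝ 2 c ∧
    ∀ x, F x = a * x.1 ^ 2 + x.1 * b x.2 + c x.2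

theorem QuadraticIn.add {a a' : ℝ} {F F' : Pt N M → ℝ} (h : QuadraticIn a F)
    (h' : QuadraticIn a' F') : QuadraticIn (a + a') (fun x => F x + F' x) := by
  obtain ⟨b, c, hb, hc, hF⟩ := h
  obtain ⟨b', c', hb', hc', hF'⟩ := h'
  exact ⟨fun X => b X + b' X, fun X => c X + c' X, hb.add hb', hc.add hc', fun x => by
    beta_reduce; rw [hF, hF']; ring⟩

theorem QuadraticIn.const_mul {a : ℝ} {F : Pt N M → ℝ} (h : QuadraticIn a F) (r : ℝ) :
    QuadraticIn (r * a) (fun x => r * F x) := by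
  obtain ⟨b, c, hb, hc, hF⟩ := h
  exact ⟨fun X => r * b X, fun X => r * c X, contDiff_const.mul hb, contDiff_const.mul hc,
    fun x => by beta_reduce; rw [hF]; ring⟩

theorem QuadraticIn.sum {κ : Type*} (s : Finset κ) {a : κ → ℝ} {F : κ → Pt N M → ℝ}
    (h : ∀ k ∈ s, QuadraticIn (a k) (F k)) :
    QuadraticIn (∑ k ∈ s, a k) (fun x => ∑ k ∈ s, F k x) := by
  classical
  induction s using Finset.induction_on with
  | empty => exact ⟨0, 0, contDiff_const, contDiff_const, fun x => by simp⟩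
  | insert k s hk ih =>
    simp only [sum_insert hk]
    exact (h k (mem_insert_self _ _)).add (ih fun j hj => h j (mem_insert_of_mem hj))

theorem quadraticIn_zero_of_contDiff {c : Wave N M → ℝ} (hc : ContDiff ℝ 2 c) :
    QuadraticIn 0 (fun x => c x.2) :=
  ⟨0, c, contDiff_const, hc, fun x => by simp⟩

theorem QuadraticIn.contDiff {a : ℝ} {F : Pt N M → ℝ} (h : QuadraticIn a F) :
    ContDiff ℝ 2 F := by
  obtain ⟨b, c, hb, hc, hF⟩ := h
  rw [funext hF]
  exact ((contDiff_const.mul (contDiff_fst.pow 2)).add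
    (contDiff_fst.mul (hb.comp contDiff_snd))).add (hc.comp contDiff_snd)

theorem QuadraticIn.differentiableAt {a : ℝ} {F : Pt N M → ℝ} (h : QuadraticIn a F)
    (x : Pt N M) : DifferentiableAt ℝ F x :=
  h.contDiff.differentiable (by norm_num) x

theorem QuadraticIn.exists_grad_fst {a : ℝ} {F : Pt N M → ℝ} (h : QuadraticIn a F) :
    ∃ b : Wave N M → ℝ, ContDiff ℝ 2 b ∧ ∀ x, (grad F x).1 = 2 * a * x.1 + b x.2 := by
  obtain ⟨b, c, hb, -, hF⟩ := h
  refine ⟨b, hb, fun x => ?_⟩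
  have h1 : HasDerivAt (fun r : ℝ => a * r ^ 2 + r * b x.2 + c x.2)
      (a * (2 * x.1) + 1 * b x.2) x.1 := by
    have := (((hasDerivAt_pow 2 x.1).const_mul a).add
      ((hasDerivAt_id x.1).mul_const (b x.2))).add_const (c x.2)
    simpa using this
  have h2 : (fun r : ℝ => F (r, x.2)) = fun r => a * r ^ 2 + r * b x.2 + c x.2 :=
    funext fun r => hF (r, x.2)
  change deriv (fun r : ℝ => F (r, x.2)) x.1 = _
  rw [h2, h1.deriv]
  ring

theorem QuadraticIn.exists_lipschitz_grad_fst {a : ℝ} {F : Pt N M → ℝ} (h : QuadraticIn a F) :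
    ∃ L, 0 ≤ L ∧ ∀ x ∈ manifold N M, ∀ y ∈ manifold N M,
      |(grad F x).1 - (grad F y).1| ≤ L * ‖x - y‖ := by
  obtain ⟨b, hb, hF⟩ := h.exists_grad_fst
  obtain ⟨L, hL0, hL⟩ := exists_lipschitz_of_contDiff (hb.of_le (by norm_num))
    (isCompact_UM (N := N) (M := M))
  refine ⟨2 * |a| + L, by positivity, fun x hx y hy => ?_⟩
  have h1 : (grad F x).1 - (grad F y).1 = 2 * a * (x - y).1 + (b x.2 - b y.2) := by
    rw [hF, hF, Prod.fst_sub]; ring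
  have h2 : |(x - y).1| ≤ ‖x - y‖ := norm_fst_le (x - y)
  have h3 : |b x.2 - b y.2| ≤ L * ‖x - y‖ := (hL _ hx _ hy).trans
    (mul_le_mul_of_nonneg_left (norm_snd_le (x - y)) hL0.le)
  rw [h1]
  refine (abs_add_le _ _).trans ?_
  rw [abs_mul, abs_mul, abs_two]
  nlinarith [mul_le_mul_of_nonneg_left h2 (abs_nonneg a)]

/-- On the manifold the Riemannian gradient grows at most linearly in `α`. -/
theorem QuadraticIn.exists_norm_grad_le {a : ℝ} {F : Pt N M → ℝ} (h : QuadraticIn a F) :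
    ∃ C, 0 ≤ C ∧ ∀ x ∈ manifold N M, ‖grad F x‖ ≤ C * (1 + |x.1|) := by
  obtain ⟨b', hb', hF'⟩ := h.exists_grad_fst
  obtain ⟨b, c, hb, hc, hF⟩ := h
  have hK := isCompact_UM (N := N) (M := M)
  obtain ⟨B', hB'⟩ := hK.exists_bound_of_continuousOn hb'.continuous.continuousOn
  obtain ⟨B, hB⟩ := hK.exists_bound_of_continuousOn
    (hb.continuous_fderiv (by norm_num)).continuousOn
  obtain ⟨C, hC⟩ := hK.exists_bound_of_continuousOn
    (hc.continuous_fderiv (by norm_num)).continuousOn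
  refine ⟨2 * |a| + |B'| + |B| + |C|, by positivity, fun x hx => ?_⟩
  have hx0 := abs_nonneg x.1
  have p1 := mul_nonneg (abs_nonneg a) hx0
  have p2 := mul_nonneg (abs_nonneg B') hx0
  have p3 := mul_nonneg (abs_nonneg B) hx0
  have p4 := mul_nonneg (abs_nonneg C) hx0
  rw [Prod.norm_def]
  refine max_le ?_ ?_
  · rw [hF', Real.norm_eq_abs]
    refine (abs_add_le _ _).trans ?_
    rw [abs_mul, abs_mul, abs_two]
    have h1 : |b' x.2| ≤ |B'| := (hB' x.2 hx).trans (le_abs_self _)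
    nlinarith [abs_nonneg a, abs_nonneg B, abs_nonneg C]
  · have h1 : HasFDerivAt (fun X => F (x.1, X)) (x.1 • fderiv ℝ b x.2 + fderiv ℝ c x.2) x.2 := by
      have h2 : (fun X => F (x.1, X)) = fun X => a * x.1 ^ 2 + x.1 * b X + c X :=
        funext fun X => hF (x.1, X)
      rw [h2]
      exact ((((hb.differentiable (by norm_num)) x.2).hasFDerivAt.const_mul x.1).const_add
        (a * x.1 ^ 2)).add ((hc.differentiable (by norm_num)) x.2).hasFDerivAt
    have h3 : ‖(grad F x).2‖ ≤ ‖x.1 • fderiv ℝ b x.2 + fderiv ℝ c x.2‖ := by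
      refine (norm_tproj_le hx _).trans ?_
      rw [gradient, LinearIsometryEquiv.norm_map, h1.fderiv]
    refine h3.trans ((norm_add_le _ _).trans ?_)
    rw [norm_smul, Real.norm_eq_abs]
    have h4 : ‖fderiv ℝ b x.2‖ ≤ |B| := (hB x.2 hx).trans (le_abs_self _)
    have h5 : ‖fderiv ℝ c x.2‖ ≤ |C| := (hC x.2 hx).trans (le_abs_self _)
    nlinarith [mul_le_mul_of_nonneg_left h4 hx0, abs_nonneg a, abs_nonneg B', abs_nonneg B]

/-! #### The losses of the waveform design problem -/

theorem contDiff_signal {n : WithTop ℕ∞} (pb : Problem M) (θ : ℝ) (k : Fin N) :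
    ContDiff ℝ n fun X : Wave N M => signal pb X θ k := by
  simp only [signal, Matrix.mulVec, dotProduct, toMat, Matrix.of_apply]
  exact ContDiff.sum fun m _ => (contDiff_piLp_apply 2).mul contDiff_const

theorem contDiff_star_dotProduct {n : WithTop ℕ∞} {u v : Wave N M → Fin N → ℂ}
    (hu : ∀ k, ContDiff ℝ n fun X => u X k) (hv : ∀ k, ContDiff ℝ n fun X => v X k) :
    ContDiff ℝ n fun X => star (u X) ⬝ᵥ v X := by
  simp only [dotProduct, Pi.star_apply]
  exact ContDiff.sum fun k _ => (Complex.conjCLE.contDiff.comp (hu k)).mul (hv k)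

theorem contDiff_corr {n : WithTop ℕ∞} (pb : Problem M) (θ₁ θ₂ : ℝ) (τ : ℕ) :
    ContDiff ℝ n fun X : Wave N M => corr pb X θ₁ θ₂ τ := by
  refine contDiff_star_dotProduct (fun k => contDiff_signal pb θ₁ k) fun k => ?_
  simp only [Matrix.mulVec, dotProduct]
  exact ContDiff.sum fun j _ => contDiff_const.mul (contDiff_signal pb θ₂ j)

theorem contDiff_delayLoss (pb : Problem M) (τ : ℕ) :
    ContDiff ℝ 2 fun X : Wave N M => delayLoss pb τ X := by
  unfold delayLoss
  refine ContDiff.add ?_ (ContDiff.sum fun p _ => (contDiff_corr pb _ _ τ).norm_sq ℝ)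
  split_ifs
  · exact contDiff_const
  · exact ContDiff.sum fun θ _ => (contDiff_corr pb _ _ τ).norm_sq ℝ

theorem quadraticIn_angleLoss (pb : Problem M) (θ : ℝ) :
    QuadraticIn (N := N) (pb.desired θ ^ 2) (angleLoss pb θ) := by
  have hp : ContDiff ℝ 2 fun X : Wave N M => star (signal pb X θ) ⬝ᵥ signal pb X θ :=
    contDiff_star_dotProduct (fun k => contDiff_signal pb θ k) fun k => contDiff_signal pb θ k
  refine ⟨fun X => -2 * pb.desired θ * (star (signal pb X θ) ⬝ᵥ signal pb X θ).re,
    fun X => ‖star (signal pb X θ) ⬝ᵥ signal pb X θ‖ ^ 2,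
    contDiff_const.mul (Complex.reCLM.contDiff.comp hp), hp.norm_sq ℝ, fun x => ?_⟩
  simp only [angleLoss, ← Complex.normSq_eq_norm_sq, Complex.normSq_apply, Complex.sub_re,
    Complex.sub_im, Complex.ofReal_re, Complex.ofReal_im]
  ring

theorem quadraticIn_sampleLoss (pb : Problem M) (c₁ c₂ : ℝ) (i : pb.angles × pb.delays) :
    QuadraticIn (N := N) (c₁ * pb.desired i.1 ^ 2) (sampleLoss pb c₁ c₂ i) := by
  have := ((quadraticIn_angleLoss (N := N) pb i.1).const_mul c₁).add
    (((quadraticIn_zero_of_contDiff (contDiff_delayLoss pb i.2)).const_mul (pb.w ^ 2)).const_mul c₂)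
  rwa [mul_zero, mul_zero, add_zero] at this

theorem quadraticIn_objective (pb : Problem M) :
    QuadraticIn (N := N) (∑ θ ∈ pb.angles, pb.desired θ ^ 2) (objective pb) := by
  have h : ContDiff ℝ 2 fun X : Wave N M => corrLevel pb X := by
    simp only [← sum_delayLoss]
    exact ContDiff.sum fun τ _ => contDiff_delayLoss pb τ
  have := (QuadraticIn.sum pb.angles fun θ _ => quadraticIn_angleLoss (N := N) pb θ).add
    ((quadraticIn_zero_of_contDiff h).const_mul (pb.w ^ 2))
  rwa [mul_zero, add_zero] at this

theorem objective_nonneg (pb : Problem M) (x : Pt N M) : 0 ≤ objective pb x := by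
  unfold objective angleLoss corrLevel
  positivity

theorem angleLoss_of_desired_eq_zero {pb : Problem M} {θ : ℝ} (h : pb.desired θ = 0)
    (x : Pt N M) (r : ℝ) : angleLoss pb θ (r, x.2) = angleLoss pb θ x := by
  simp [angleLoss, h]

theorem grad_sampleLoss_fst_of_desired_eq_zero {pb : Problem M} (c₁ c₂ : ℝ)
    {i : pb.angles × pb.delays} (h : pb.desired i.1 = 0) (x : Pt N M) :
    (grad (sampleLoss pb c₁ c₂ i) x).1 = 0 := by
  change deriv (fun r => sampleLoss pb c₁ c₂ i (r, x.2)) x.1 = 0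
  simp only [sampleLoss, angleLoss_of_desired_eq_zero h, deriv_const]

theorem grad_objective_fst_of_desired_eq_zero {pb : Problem M}
    (h : ∀ θ ∈ pb.angles, pb.desired θ = 0) (x : Pt N M) :
    (grad (objective pb) x).1 = 0 := by
  change deriv (fun r => objective pb (r, x.2)) x.1 = 0
  have : ∀ r, objective pb (r, x.2) = objective pb x := fun r => by
    unfold objective
    rw [sum_congr rfl fun θ hθ => angleLoss_of_desired_eq_zero (h θ hθ) x r]
  simp only [this, deriv_const]

/-! #### The gradient noise -/

/-- The difference of the gradients of a sampled loss and of the objective. -/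
noncomputable def gradDiff (pb : Problem M) (c₁ c₂ : ℝ) (i : pb.angles × pb.delays)
    (x : Pt N M) : Pt N M :=
  grad (sampleLoss pb c₁ c₂ i) x - grad (objective pb) x

/-- The deviation of the modified stochastic gradient at `x` with reference point `y` from the
gradient of the objective at `x`. -/
noncomputable def noise (pb : Problem M) (c₁ c₂ : ℝ) (i : pb.angles × pb.delays)
    (y x : Pt N M) : Pt N M :=
  transport x (gradDiff pb c₁ c₂ i x - gradDiff pb c₁ c₂ i y)

theorem modGrad_eq_add_noise (pb : Problem M) (c₁ c₂ : ℝ) (i : pb.angles × pb.delays)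
    (y : Pt N M) {x : Pt N M} (hx : x ∈ manifold N M) :
    modGrad pb c₁ c₂ i y x = grad (objective pb) x + noise pb c₁ c₂ i y x := by
  have h1 : ∀ ξ η, transport x (ξ - η) = transport x ξ - transport x η := (transportL x).map_sub
  unfold noise gradDiff modGrad
  rw [h1, h1, h1, h1, transport_eq_self (grad_mem_tangent _ hx),
    transport_eq_self (grad_mem_tangent _ hx)]
  abel

theorem modGrad_mem_tangent (pb : Problem M) (c₁ c₂ : ℝ) (i : pb.angles × pb.delays)
    (y : Pt N M) {x : Pt N M} (hx : x ∈ manifold N M) :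
    (modGrad pb c₁ c₂ i y x).2 ∈ tangent x.2 := by
  intro p
  have h1 := grad_mem_tangent (sampleLoss pb c₁ c₂ i) hx p
  have h2 := tproj_mem_tangent hx
    (grad (sampleLoss pb c₁ c₂ i) y - grad (objective pb) y).2 p
  change (((grad (sampleLoss pb c₁ c₂ i) x).2 p - tproj x.2
    (grad (sampleLoss pb c₁ c₂ i) y - grad (objective pb) y).2 p) * conj (x.2 p)).re = 0
  rw [sub_mul, Complex.sub_re, h1, h2, sub_zero]

/-- The modified stochastic gradient grows at most linearly in the scaling factors. -/
theorem exists_norm_modGrad_le (pb : Problem M) (c₁ c₂ : ℝ) :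
    ∃ C, 0 ≤ C ∧ ∀ i, ∀ y ∈ manifold N M, ∀ x ∈ manifold N M, ∀ D : ℝ,
      1 + |x.1| ≤ D → 1 + |y.1| ≤ D → ‖modGrad pb c₁ c₂ i y x‖ ≤ C * D := by
  choose C hC0 hC using fun i => (quadraticIn_sampleLoss (N := N) pb c₁ c₂ i).exists_norm_grad_le
  obtain ⟨B, hB0, hB⟩ := (quadraticIn_objective (N := N) pb).exists_norm_grad_le
  have hS : ∀ i, C i ≤ ∑ j, C j := fun i => single_le_sum (fun j _ => hC0 j) (mem_univ i)
  have hS0 : 0 ≤ ∑ j, C j := sum_nonneg fun j _ => hC0 j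
  refine ⟨2 * ∑ j, C j + B, by positivity, fun i y hy x hx D hxD hyD => ?_⟩
  have hD : 0 ≤ D := by linarith [abs_nonneg x.1]
  have h1 : ‖grad (sampleLoss pb c₁ c₂ i) x‖ ≤ (∑ j, C j) * D :=
    (hC i x hx).trans (mul_le_mul (hS i) hxD (by positivity) hS0)
  have h2 : ‖grad (sampleLoss pb c₁ c₂ i) y‖ ≤ (∑ j, C j) * D :=
    (hC i y hy).trans (mul_le_mul (hS i) hyD (by positivity) hS0)
  have h3 : ‖grad (objective pb) y‖ ≤ B * D :=
    (hB y hy).trans (mul_le_mul_of_nonneg_left hyD hB0)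
  unfold modGrad
  refine (norm_sub_le _ _).trans ?_
  have h4 := (norm_transport_le hx (grad (sampleLoss pb c₁ c₂ i) y - grad (objective pb) y)).trans
    (norm_sub_le _ _)
  linarith

/-- The `α`-component of the noise is bounded by the distance from the reference point, with a
constant valid on the whole (noncompact) manifold. -/
theorem exists_abs_noise_fst_le (pb : Problem M) (c₁ c₂ : ℝ) :
    ∃ L, 0 ≤ L ∧ ∀ i, ∀ y ∈ manifold N M, ∀ x ∈ manifold N M,
      |(noise pb c₁ c₂ i y x).1| ≤ L * ‖x - y‖ := by
  choose C hC0 hC using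
    fun i => (quadraticIn_sampleLoss (N := N) pb c₁ c₂ i).exists_lipschitz_grad_fst
  obtain ⟨B, hB0, hB⟩ := (quadraticIn_objective (N := N) pb).exists_lipschitz_grad_fst
  have hS : ∀ i, C i ≤ ∑ j, C j := fun i => single_le_sum (fun j _ => hC0 j) (mem_univ i)
  have hS0 : 0 ≤ ∑ j, C j := sum_nonneg fun j _ => hC0 j
  refine ⟨∑ j, C j + B, by positivity, fun i y hy x hx => ?_⟩
  have h1 : (noise pb c₁ c₂ i y x).1 =
      ((grad (sampleLoss pb c₁ c₂ i) x).1 - (grad (sampleLoss pb c₁ c₂ i) y).1) -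
        ((grad (objective pb) x).1 - (grad (objective pb) y).1) := by
    simp only [noise, transport, gradDiff, Prod.fst_sub]; ring
  rw [h1]
  refine (abs_sub _ _).trans ?_
  have h2 := (hC i x hx y hy).trans (mul_le_mul_of_nonneg_right (hS i) (norm_nonneg _))
  linarith [hB x hx y hy]

theorem exists_norm_noise_le (pb : Problem M) (c₁ c₂ : ℝ) (K : ℝ) :
    ∃ L, 0 ≤ L ∧ ∀ i, ∀ y ∈ slab N M K, ∀ x ∈ slab N M K,
      ‖noise pb c₁ c₂ i y x‖ ≤ L * ‖x - y‖ := by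
  choose C hC0 hC using fun i => exists_lipschitz_of_contDiff
    (contDiff_grad (quadraticIn_sampleLoss (N := N) pb c₁ c₂ i).contDiff) (isCompact_slab K)
  obtain ⟨B, hB0, hB⟩ := exists_lipschitz_of_contDiff
    (contDiff_grad (quadraticIn_objective (N := N) pb).contDiff) (isCompact_slab K)
  have hS : ∀ i, C i ≤ ∑ j, C j := fun i => single_le_sum (fun j _ => (hC0 j).le) (mem_univ i)
  have hS0 : 0 ≤ ∑ j, C j := sum_nonneg fun j _ => (hC0 j).le
  refine ⟨∑ j, C j + B, by positivity, fun i y hy x hx => ?_⟩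
  refine (norm_transport_le hx.2 _).trans ?_
  have h1 : gradDiff pb c₁ c₂ i x - gradDiff pb c₁ c₂ i y =
      (grad (sampleLoss pb c₁ c₂ i) x - grad (sampleLoss pb c₁ c₂ i) y) -
        (grad (objective pb) x - grad (objective pb) y) := by
    unfold gradDiff; abel
  rw [h1]
  refine (norm_sub_le _ _).trans ?_
  have h2 := (hC i x hx y hy).trans (mul_le_mul_of_nonneg_right (hS i) (norm_nonneg _))
  linarith [hB x hx y hy]

/-- With the scaling `c₁ = |Θ|`, `c₂ = |𝒟|` the noise is centred, whatever the joint distribution of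
the angle and the delay with uniform marginals. -/
theorem sum_smul_noise_eq_zero (pb : Problem M) [Nonempty pb.angles]
    {p : pb.angles × pb.delays → ℝ}
    (hp₁ : ∀ s, ∑ r, p (s, r) = 1 / (pb.angles.card : ℝ))
    (hp₂ : ∀ r, ∑ s, p (s, r) = 1 / (pb.delays.card : ℝ)) (y x : Pt N M) :
    ∑ i, p i • noise pb pb.angles.card pb.delays.card i y x = 0 := by
  have hc₁ : (pb.angles.card : ℝ) ≠ 0 := by
    have : 0 < pb.angles.card := card_pos.2 (by
      obtain ⟨s, hs⟩ := ‹Nonempty pb.angles›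
      exact ⟨s, hs⟩)
    positivity
  have htot : ∑ i, p i = 1 := by
    rw [Fintype.sum_prod_type]
    simp only [hp₁]
    simp [hc₁]
  have hmean : ∀ z : Pt N M,
      ∑ i, p i * sampleLoss pb pb.angles.card pb.delays.card i z = objective pb z := by
    intro z
    simp only [sampleLoss, mul_add, sum_add_distrib]
    unfold objective
    congr 1
    · rw [Fintype.sum_prod_type, ← sum_coe_sort pb.angles]
      refine sum_congr rfl fun s _ => ?_
      dsimp only
      rw [← sum_mul, hp₁]
      field_simp
    · rw [Fintype.sum_prod_type_right, ← sum_delayLoss, mul_sum,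
        ← sum_coe_sort pb.delays fun τ => pb.w ^ 2 * delayLoss pb τ z.2]
      refine sum_congr rfl fun r _ => ?_
      have hc₂ : (pb.delays.card : ℝ) ≠ 0 := by
        have : 0 < pb.delays.card := card_pos.2 ⟨r, r.2⟩
        positivity
      dsimp only
      rw [← sum_mul, hp₂]
      field_simp
  have hgrad : ∀ z : Pt N M,
      ∑ i, p i • grad (sampleLoss pb pb.angles.card pb.delays.card i) z =
        grad (objective pb) z := by
    intro z
    have hd := fun i => (quadraticIn_sampleLoss (N := N) pb pb.angles.card pb.delays.card
      i).differentiableAt z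
    rw [grad_eq_gradOf ((quadraticIn_objective pb).differentiableAt z), ← funext hmean,
      fderiv_fun_sum fun i _ => (hd i).const_mul _, map_sum]
    refine sum_congr rfl fun i _ => ?_
    rw [grad_eq_gradOf (hd i), fderiv_const_mul (hd i), map_smul]
  have hdiff : ∀ z : Pt N M, ∑ i, p i • gradDiff pb pb.angles.card pb.delays.card i z = 0 := by
    intro z
    simp only [gradDiff, smul_sub, sum_sub_distrib, hgrad, ← sum_smul, htot, one_smul, sub_self]
  have h1 : ∀ i, p i • noise pb pb.angles.card pb.delays.card i y x = transportL x
      (p i • gradDiff pb pb.angles.card pb.delays.card i x -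
        p i • gradDiff pb pb.angles.card pb.delays.card i y) := fun i => by
    rw [← smul_sub, map_smul]; rfl
  simp only [h1]
  rw [← map_sum, sum_sub_distrib, hdiff, hdiff, sub_zero, map_zero]

end UMSVRG

/-! ### The algorithm as a single sequence of steps -/

namespace UMSVRG

variable {N M : ℕ}

/-- The algorithm with consecutively numbered steps: the pairs of the reference point and the
iterate. The reference point is replaced by the new iterate after the steps `k` with `e k`. -/
noncomputable def run (pb : Problem M) (c₁ c₂ : ℝ) (T : ℕ → ℝ) (e : ℕ → Bool)
    (x₀ : Pt N M) (s : ℕ → pb.angles × pb.delays) : ℕ → Pt N M × Pt N M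
  | 0 => (x₀, x₀)
  | k + 1 =>
    let p := run pb c₁ c₂ T e x₀ s k
    let x := retract p.2 (-(T k) • modGrad pb c₁ c₂ (s k) p.1 p.2)
    (if e k then x else p.1, x)

/-- The running maximum of `1 + |α|`. -/
noncomputable def growth (pb : Problem M) (c₁ c₂ : ℝ) (T : ℕ → ℝ) (e : ℕ → Bool)
    (x₀ : Pt N M) (s : ℕ → pb.angles × pb.delays) (k : ℕ) : ℝ :=
  partialSups (fun j => 1 + |(run pb c₁ c₂ T e x₀ s j).2.1|) k

/-- The gradient noise of step `k` when the sample is `i`. -/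
noncomputable def runNoise (pb : Problem M) (c₁ c₂ : ℝ) (T : ℕ → ℝ) (e : ℕ → Bool)
    (x₀ : Pt N M) (s : ℕ → pb.angles × pb.delays) (k : ℕ)
    (i : pb.angles × pb.delays) : Pt N M :=
  noise pb c₁ c₂ i (run pb c₁ c₂ T e x₀ s k).1 (run pb c₁ c₂ T e x₀ s k).2

/-- The sum of the step sizes since the last change of the reference point. -/
def elapsed (T : ℕ → ℝ) (e : ℕ → Bool) : ℕ → ℝ
  | 0 => 0
  | k + 1 => if e k then 0 else elapsed T e k + T k

section Run

variable {pb : Problem M} {c₁ c₂ : ℝ} {T : ℕ → ℝ} {e : ℕ → Bool} {x₀ : Pt N M}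
  {s : ℕ → pb.angles × pb.delays}

theorem smul_mem_tangent {X ξ : Wave N M} (hξ : ξ ∈ tangent X) (r : ℝ) : r • ξ ∈ tangent X := by
  intro p
  rw [PiLp.smul_apply, Complex.real_smul, mul_assoc, Complex.re_ofReal_mul, hξ p, mul_zero]

theorem run_mem_manifold (hx₀ : x₀ ∈ manifold N M) (k : ℕ) :
    (run pb c₁ c₂ T e x₀ s k).1 ∈ manifold N M ∧ (run pb c₁ c₂ T e x₀ s k).2 ∈ manifold N M := by
  induction k with
  | zero => exact ⟨hx₀, hx₀⟩
  | succ k ih =>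
    have h : (run pb c₁ c₂ T e x₀ s (k + 1)).2 ∈ manifold N M :=
      retract_mem_manifold ih.2 (smul_mem_tangent (modGrad_mem_tangent pb c₁ c₂ (s k) _ ih.2) _)
    refine ⟨?_, h⟩
    change (if e k then (run pb c₁ c₂ T e x₀ s (k + 1)).2 else (run pb c₁ c₂ T e x₀ s k).1) ∈ _
    split_ifs
    exacts [h, ih.1]

theorem growth_mono : Monotone (growth pb c₁ c₂ T e x₀ s) :=
  (partialSups fun j => 1 + |(run pb c₁ c₂ T e x₀ s j).2.1|).monotone

theorem iterate_le_growth (k : ℕ) :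
    1 + |(run pb c₁ c₂ T e x₀ s k).2.1| ≤ growth pb c₁ c₂ T e x₀ s k :=
  le_partialSups (fun j => 1 + |(run pb c₁ c₂ T e x₀ s j).2.1|) k

theorem one_le_growth (k : ℕ) : 1 ≤ growth pb c₁ c₂ T e x₀ s k := by
  have := iterate_le_growth (pb := pb) (c₁ := c₁) (c₂ := c₂) (T := T) (e := e) (x₀ := x₀) (s := s) k
  linarith [abs_nonneg (run pb c₁ c₂ T e x₀ s k).2.1]

theorem reference_le_growth (k : ℕ) :
    1 + |(run pb c₁ c₂ T e x₀ s k).1.1| ≤ growth pb c₁ c₂ T e x₀ s k := by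
  induction k with
  | zero => exact iterate_le_growth 0
  | succ k ih =>
    have h : (run pb c₁ c₂ T e x₀ s (k + 1)).1 =
      if e k then (run pb c₁ c₂ T e x₀ s (k + 1)).2 else (run pb c₁ c₂ T e x₀ s k).1 := rfl
    rw [h]
    split_ifs
    · exact iterate_le_growth (k + 1)
    · exact ih.trans (growth_mono k.le_succ)

theorem run_mem_slab (hx₀ : x₀ ∈ manifold N M) {k : ℕ} {K : ℝ}
    (hK : growth pb c₁ c₂ T e x₀ s k ≤ K) :
    (run pb c₁ c₂ T e x₀ s k).1 ∈ slab N M K ∧ (run pb c₁ c₂ T e x₀ s k).2 ∈ slab N M K := by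
  have h := run_mem_manifold (pb := pb) (c₁ := c₁) (c₂ := c₂) (T := T) (e := e) (s := s) hx₀ k
  have h1 := iterate_le_growth (pb := pb) (c₁ := c₁) (c₂ := c₂) (T := T) (e := e) (x₀ := x₀)
    (s := s) k
  have h2 := reference_le_growth (pb := pb) (c₁ := c₁) (c₂ := c₂) (T := T) (e := e) (x₀ := x₀)
    (s := s) k
  exact ⟨mem_slab h.1 (by linarith), mem_slab h.2 (by linarith)⟩

theorem run_dependsOn (k : ℕ) :
    DependsOn (fun s => run pb c₁ c₂ T e x₀ s k) (Set.Iio k) := by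
  induction k with
  | zero => exact fun _ _ _ => rfl
  | succ k ih =>
    intro s s' h
    have h1 : run pb c₁ c₂ T e x₀ s k = run pb c₁ c₂ T e x₀ s' k :=
      ih fun j hj => h j (Nat.lt_succ_of_lt hj)
    simp only [run, h1, h k (Nat.lt_succ_self k)]

theorem growth_dependsOn (k : ℕ) :
    DependsOn (fun s => growth pb c₁ c₂ T e x₀ s k) (Set.Iio k) := by
  intro s s' h
  simp only [growth, partialSups_apply]
  refine sup'_congr _ rfl fun j hj => ?_
  have h1 : run pb c₁ c₂ T e x₀ s j = run pb c₁ c₂ T e x₀ s' j :=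
    run_dependsOn j fun i hi => h i (lt_of_lt_of_le hi (mem_Iic.1 hj))
  rw [h1]

theorem runNoise_dependsOn (k : ℕ) (i : pb.angles × pb.delays) :
    DependsOn (fun s => runNoise pb c₁ c₂ T e x₀ s k i) (Set.Iio k) := by
  intro s s' h
  have h1 : run pb c₁ c₂ T e x₀ s k = run pb c₁ c₂ T e x₀ s' k := run_dependsOn k h
  simp only [runNoise, h1]

theorem run_succ_snd (hx₀ : x₀ ∈ manifold N M) (k : ℕ) :
    (run pb c₁ c₂ T e x₀ s (k + 1)).2 = retract (run pb c₁ c₂ T e x₀ s k).2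
      (-(T k) • (grad (objective pb) (run pb c₁ c₂ T e x₀ s k).2 +
        runNoise pb c₁ c₂ T e x₀ s k (s k))) := by
  rw [runNoise, ← modGrad_eq_add_noise pb c₁ c₂ _ _ (run_mem_manifold hx₀ k).2]
  rfl

theorem run_step_mem_tangent (hx₀ : x₀ ∈ manifold N M) (k : ℕ) (r : ℝ) :
    (r • (grad (objective pb) (run pb c₁ c₂ T e x₀ s k).2 +
      runNoise pb c₁ c₂ T e x₀ s k (s k))).2 ∈ tangent (run pb c₁ c₂ T e x₀ s k).2.2 := by
  rw [runNoise, ← modGrad_eq_add_noise pb c₁ c₂ _ _ (run_mem_manifold hx₀ k).2]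
  exact smul_mem_tangent (modGrad_mem_tangent pb c₁ c₂ _ _ (run_mem_manifold hx₀ k).2) r

/-- If the series of the normalized noise of the `α`-components converges, the scaling factors `α`
stay bounded. -/
theorem exists_growth_le (hx₀ : x₀ ∈ manifold N M) (hT0 : ∀ k, 0 ≤ T k)
    (hT : Tendsto T atTop (𝓝 0))
    (h₁ : SeriesConverges fun k => T k *
      ((runNoise pb c₁ c₂ T e x₀ s k (s k)).1 / growth pb c₁ c₂ T e x₀ s k)) :
    ∃ K, ∀ k, growth pb c₁ c₂ T e x₀ s k ≤ K := by
  have hstep : ∀ k, (run pb c₁ c₂ T e x₀ s (k + 1)).2.1 = (run pb c₁ c₂ T e x₀ s k).2.1 -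
      T k * (grad (objective pb) (run pb c₁ c₂ T e x₀ s k).2).1 -
        T k * (runNoise pb c₁ c₂ T e x₀ s k (s k)).1 := fun k => by
    rw [run_succ_snd hx₀]
    simp only [retract, Prod.smul_fst, Prod.fst_add, smul_eq_mul]
    ring
  by_cases hd : ∀ θ ∈ pb.angles, pb.desired θ = 0
  · -- The losses do not depend on `α`, so that `α` is constant.
    have hconst : ∀ k, (run pb c₁ c₂ T e x₀ s k).2.1 = x₀.1 := by
      intro k
      induction k with
      | zero => rfl
      | succ k ih =>
        rw [hstep, ih]
        simp only [runNoise, noise, transport, gradDiff, Prod.fst_sub,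
          grad_objective_fst_of_desired_eq_zero hd,
          grad_sampleLoss_fst_of_desired_eq_zero c₁ c₂ (hd _ (s k).1.2)]
        ring
    refine ⟨1 + |x₀.1|, fun k => partialSups_le _ _ _ fun j _ => ?_⟩
    rw [hconst]
  · have ha : 0 < ∑ θ ∈ pb.angles, pb.desired θ ^ 2 := by
      push Not at hd
      obtain ⟨θ, hθ, hθ0⟩ := hd
      exact sum_pos' (fun _ _ => sq_nonneg _) ⟨θ, hθ, by positivity⟩
    obtain ⟨b, hb, hgrad⟩ := (quadraticIn_objective (N := N) pb).exists_grad_fst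
    obtain ⟨B, hB⟩ := (isCompact_UM (N := N) (M := M)).exists_bound_of_continuousOn
      hb.continuous.continuousOn
    refine exists_bound_of_perturbed_recursion
      (α := fun k => (run pb c₁ c₂ T e x₀ s k).2.1) (t := T)
      (e := fun k => (runNoise pb c₁ c₂ T e x₀ s k (s k)).1)
      (b := fun k => b (run pb c₁ c₂ T e x₀ s k).2.2) (mul_pos two_pos ha) hT0 hT
      (fun k => hB _ (run_mem_manifold hx₀ k).2) (fun k => ?_) rfl h₁
    rw [hstep, hgrad]

/-- Convergence of the run, given that the series of the noise converge: in the `α`-component when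
normalized by the growth, in all components and in the direction of the gradient as long as the
growth is bounded. -/
theorem run_tendsto (hx₀ : x₀ ∈ manifold N M) (hT0 : ∀ k, 0 ≤ T k)
    (hT2 : Summable fun k => T k ^ 2) (hT1 : ¬ Summable T)
    (h₁ : SeriesConverges fun k => T k *
      ((runNoise pb c₁ c₂ T e x₀ s k (s k)).1 / growth pb c₁ c₂ T e x₀ s k))
    (h₂ : ∀ K : ℕ, SeriesConverges fun k => T k •
      if growth pb c₁ c₂ T e x₀ s k ≤ K then runNoise pb c₁ c₂ T e x₀ s k (s k) else 0)
    (h₃ : ∀ K : ℕ, SeriesConverges fun k => T k •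
      if growth pb c₁ c₂ T e x₀ s k ≤ K then
        metric (grad (objective pb) (run pb c₁ c₂ T e x₀ s k).2)
          (runNoise pb c₁ c₂ T e x₀ s k (s k)) else 0) :
    (∃ c, Tendsto (fun k => objective pb (run pb c₁ c₂ T e x₀ s k).2) atTop (𝓝 c)) ∧
      Tendsto (fun k => grad (objective pb) (run pb c₁ c₂ T e x₀ s k).2) atTop (𝓝 0) := by
  have hT : Tendsto T atTop (𝓝 0) := by
    have := (hT2.tendsto_atTop_zero).sqrt
    simpa only [Real.sqrt_sq (hT0 _), Real.sqrt_zero] using this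
  obtain ⟨K', hK'⟩ := exists_growth_le hx₀ hT0 hT h₁
  obtain ⟨K, hK⟩ := exists_nat_ge K'
  have hgK : ∀ k, growth pb c₁ c₂ T e x₀ s k ≤ K := fun k => (hK' k).trans hK
  specialize h₂ K
  specialize h₃ K
  simp only [hgK, if_true] at h₂ h₃
  have hy : ∀ k, (run pb c₁ c₂ T e x₀ s k).1 ∈ slab N M K := fun k => (run_mem_slab hx₀ (hgK k)).1
  have hx : ∀ k, (run pb c₁ c₂ T e x₀ s k).2 ∈ slab N M K := fun k => (run_mem_slab hx₀ (hgK k)).2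
  obtain ⟨C, hC0, hC⟩ := exists_norm_modGrad_le (N := N) pb c₁ c₂
  set x : ℕ → Pt N M := fun k => (run pb c₁ c₂ T e x₀ s k).2 with hxdef
  set g : ℕ → Pt N M := fun k => grad (objective pb) (x k) with hgdef
  set ν : ℕ → Pt N M := fun k => runNoise pb c₁ c₂ T e x₀ s k (s k) with hνdef
  have hς : ∀ k, ‖g k + ν k‖ ≤ C * K := fun k => by
    have h := hC (s k) _ (hy k).2 _ (hx k).2 K ((iterate_le_growth k).trans (hgK k))
      ((reference_le_growth k).trans (hgK k))
    rwa [modGrad_eq_add_noise pb c₁ c₂ _ _ (hx k).2] at h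
  have hstep : ∀ k, x (k + 1) = retract (x k) (-(T k) • (g k + ν k)) := run_succ_snd hx₀
  have htan : ∀ k r, (r • (g k + ν k)).2 ∈ tangent (x k).2 := run_step_mem_tangent hx₀
  have hξ : ∀ k, ‖-(T k) • (g k + ν k)‖ ^ 2 ≤ (C * K) ^ 2 * T k ^ 2 := fun k => by
    rw [norm_smul, norm_neg, Real.norm_of_nonneg (hT0 k), mul_pow, mul_comm]
    gcongr
    exact hς k
  -- The descent of the objective.
  obtain ⟨A, hA0, hA⟩ := exists_retract_taylor_bound (quadraticIn_objective (N := N) pb).contDiff K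
  have hrem : Summable fun k => objective pb (x (k + 1)) - objective pb (x k) -
      metric (g k) (-(T k) • (g k + ν k)) := by
    refine Summable.of_norm_bounded (hT2.mul_left (A * (C * K) ^ 2)) fun k => ?_
    have h := hA (x k) (hx k) _ (htan k _) (by rw [← hstep]; exact hx (k + 1))
    rw [← hstep k] at h
    rw [mul_assoc]
    exact h.trans (mul_le_mul_of_nonneg_left (hξ k) hA0)
  have hdesc := summable_and_tendsto_of_perturbed_descent
    (f := fun k => objective pb (x k)) (d := fun k => T k * metric (g k) (g k))
    (fun k => objective_nonneg pb _)
    (fun k => mul_nonneg (hT0 k) ((sq_nonneg _).trans (sq_norm_le_metric _)))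
    (hrem.seriesConverges.add h₃.neg) fun k => by
      rw [metric_smul_right, metric_add_right, smul_eq_mul]; ring
  refine ⟨hdesc.2, ?_⟩
  -- The gradients tend to zero.
  obtain ⟨L, hL0, hL⟩ := exists_lipschitz_of_contDiff
    (contDiff_grad (quadraticIn_objective (N := N) pb).contDiff) (isCompact_slab (K : ℝ))
  have hρ : Summable fun k => x (k + 1) - (x k + -(T k) • (g k + ν k)) := by
    refine Summable.of_norm_bounded (hT2.mul_left ((C * K) ^ 2)) fun k => ?_
    obtain ⟨ρ, h, -, h2⟩ := exists_retract_eq (hx k).2 (htan k (-(T k)))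
    rw [hstep, h, add_sub_cancel_left]
    exact h2.trans (hξ k)
  refine tendsto_zero_of_summable_sq (z := x) (t := T) hL0 hT0 hT hT1
    (v := fun k => (x (k + 1) - (x k + -(T k) • (g k + ν k))) + -(T k • ν k))
    (fun k => ?_) (hρ.seriesConverges.add h₂.neg) (fun i j => hL _ (hx i) _ (hx j)) ?_
  · rw [neg_smul, smul_add]; abel
  · refine Summable.of_nonneg_of_le (fun k => mul_nonneg (hT0 k) (sq_nonneg _)) (fun k => ?_)
      hdesc.1
    exact mul_le_mul_of_nonneg_left (sq_norm_le_metric _) (hT0 k)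

/-! #### Short inner loops -/

theorem elapsed_nonneg (hT0 : ∀ k, 0 ≤ T k) (k : ℕ) : 0 ≤ elapsed T e k := by
  induction k with
  | zero => exact le_rfl
  | succ k ih =>
    simp only [elapsed]
    split_ifs
    exacts [le_rfl, add_nonneg ih (hT0 k)]

/-- The distance from the reference point is at most the path length since it was set. -/
theorem exists_norm_run_sub_le (hx₀ : x₀ ∈ manifold N M) (hT0 : ∀ k, 0 ≤ T k) :
    ∃ C, 0 ≤ C ∧ ∀ k, ‖(run pb c₁ c₂ T e x₀ s k).2 - (run pb c₁ c₂ T e x₀ s k).1‖ ≤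
      C * growth pb c₁ c₂ T e x₀ s k * elapsed T e k := by
  obtain ⟨C, hC0, hC⟩ := exists_norm_modGrad_le (N := N) pb c₁ c₂
  refine ⟨2 * C, by positivity, fun k => ?_⟩
  induction k with
  | zero => simp [run, elapsed]
  | succ k ih =>
    by_cases he : e k
    · have h1 : (run pb c₁ c₂ T e x₀ s (k + 1)).1 = (run pb c₁ c₂ T e x₀ s (k + 1)).2 := if_pos he
      simp [h1, elapsed, he]
    · have h1 : (run pb c₁ c₂ T e x₀ s (k + 1)).1 = (run pb c₁ c₂ T e x₀ s k).1 := if_neg he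
      have h2 := norm_retract_sub_le (run_mem_manifold (pb := pb) (c₁ := c₁) (c₂ := c₂) (T := T)
        (e := e) (s := s) hx₀ k).2 (run_step_mem_tangent hx₀ k (-(T k)))
      rw [← run_succ_snd hx₀, runNoise,
        ← modGrad_eq_add_noise pb c₁ c₂ _ _ (run_mem_manifold hx₀ k).2, norm_smul, norm_neg,
        Real.norm_of_nonneg (hT0 k)] at h2
      have h3 := hC (s k) _ (run_mem_manifold (pb := pb) (c₁ := c₁) (c₂ := c₂) (T := T)
        (e := e) (s := s) hx₀ k).1 _ (run_mem_manifold hx₀ k).2 _ (iterate_le_growth k)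
        (reference_le_growth k)
      have h4 := mul_le_mul_of_nonneg_left h3 (hT0 k)
      have h5 : growth pb c₁ c₂ T e x₀ s k ≤ growth pb c₁ c₂ T e x₀ s (k + 1) :=
        growth_mono k.le_succ
      have h6 : 0 ≤ elapsed T e k + T k := add_nonneg (elapsed_nonneg hT0 k) (hT0 k)
      have h7 := mul_le_mul_of_nonneg_left h5 (mul_nonneg (mul_nonneg two_pos.le hC0) h6)
      have h8 := norm_sub_le_norm_sub_add_norm_sub (run pb c₁ c₂ T e x₀ s (k + 1)).2
        (run pb c₁ c₂ T e x₀ s k).2 (run pb c₁ c₂ T e x₀ s k).1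
      rw [h1]
      simp only [elapsed, he, Bool.false_eq_true, if_false]
      linarith

/-- If the step sizes, weighted with the time elapsed since the last change of the reference point,
are summable, then the noise is absolutely summable, whatever the samples are. -/
theorem run_tendsto_of_summable_elapsed (hx₀ : x₀ ∈ manifold N M) (hT0 : ∀ k, 0 ≤ T k)
    (hT2 : Summable fun k => T k ^ 2) (hT1 : ¬ Summable T)
    (hE : Summable fun k => T k * elapsed T e k) :
    (∃ c, Tendsto (fun k => objective pb (run pb c₁ c₂ T e x₀ s k).2) atTop (𝓝 c)) ∧
      Tendsto (fun k => grad (objective pb) (run pb c₁ c₂ T e x₀ s k).2) atTop (𝓝 0) := by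
  obtain ⟨C, hC0, hC⟩ := exists_norm_run_sub_le (pb := pb) (c₁ := c₁) (c₂ := c₂) (e := e) (s := s)
    hx₀ hT0
  have hbig : ∀ (K : ℕ), ∃ B, 0 ≤ B ∧ ∀ k, growth pb c₁ c₂ T e x₀ s k ≤ K →
      ‖runNoise pb c₁ c₂ T e x₀ s k (s k)‖ ≤ B * elapsed T e k := by
    intro K
    obtain ⟨L, hL0, hL⟩ := exists_norm_noise_le (N := N) pb c₁ c₂ K
    refine ⟨L * (C * K), by positivity, fun k hk => ?_⟩
    have h1 := hL (s k) _ (run_mem_slab hx₀ hk).1 _ (run_mem_slab hx₀ hk).2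
    refine h1.trans ?_
    rw [mul_assoc]
    refine mul_le_mul_of_nonneg_left ((hC k).trans ?_) hL0
    exact mul_le_mul_of_nonneg_right (mul_le_mul_of_nonneg_left hk hC0) (elapsed_nonneg hT0 k)
  refine run_tendsto hx₀ hT0 hT2 hT1 ?_ (fun K => ?_) fun K => ?_
  · obtain ⟨L, hL0, hL⟩ := exists_abs_noise_fst_le (N := N) pb c₁ c₂
    refine Summable.seriesConverges ?_
    refine Summable.of_norm_bounded (hE.mul_left (L * C)) fun k => ?_
    have h0 : 0 < growth pb c₁ c₂ T e x₀ s k := one_pos.trans_le (one_le_growth k)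
    rw [norm_mul, norm_div, Real.norm_of_nonneg (hT0 k), Real.norm_of_nonneg h0.le,
      mul_left_comm]
    refine mul_le_mul_of_nonneg_left ?_ (hT0 k)
    rw [div_le_iff₀ h0, Real.norm_eq_abs]
    exact (hL (s k) _ (run_mem_manifold hx₀ k).1 _ (run_mem_manifold hx₀ k).2).trans
      ((mul_le_mul_of_nonneg_left (hC k) hL0).trans (le_of_eq (by ring)))
  · obtain ⟨B, hB0, hB⟩ := hbig K
    refine Summable.seriesConverges ?_
    refine Summable.of_norm_bounded (hE.mul_left B) fun k => ?_
    rw [norm_smul, Real.norm_of_nonneg (hT0 k), mul_left_comm]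
    refine mul_le_mul_of_nonneg_left ?_ (hT0 k)
    split_ifs with h
    · exact hB k h
    · rw [norm_zero]; exact mul_nonneg hB0 (elapsed_nonneg hT0 k)
  · obtain ⟨B, hB0, hB⟩ := hbig K
    obtain ⟨A, hA0, hA⟩ := (quadraticIn_objective (N := N) pb).exists_norm_grad_le
    refine Summable.seriesConverges ?_
    refine Summable.of_norm_bounded (hE.mul_left (2 * (A * K) * B)) fun k => ?_
    rw [norm_smul, Real.norm_of_nonneg (hT0 k), mul_left_comm]
    refine mul_le_mul_of_nonneg_left ?_ (hT0 k)
    split_ifs with h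
    · refine (abs_metric_le _ _).trans ?_
      have h1 := (hA _ (run_mem_manifold (T := T) (e := e) (s := s) (pb := pb) (c₁ := c₁)
        (c₂ := c₂) hx₀ k).2).trans
        (mul_le_mul_of_nonneg_left ((iterate_le_growth k).trans h) hA0)
      rw [mul_assoc (2 * (A * K))]
      exact mul_le_mul (mul_le_mul_of_nonneg_left h1 two_pos.le) (hB k h) (norm_nonneg _)
        (by positivity)
    · rw [norm_zero]
      exact mul_nonneg (by positivity) (elapsed_nonneg hT0 k)

/-! #### Unbiased samples -/

/-- For unbiased sampled losses the noise series converge almost surely as martingales. -/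
theorem ae_run_tendsto {Ω : Type*} [MeasurableSpace Ω] {μ : Measure Ω} [IsProbabilityMeasure μ]
    [Nonempty pb.angles] {I : ℕ → Ω → pb.angles × pb.delays} (hI : ∀ k, Measurable (I k))
    (hind : iIndepFun I μ)
    (hp₁ : ∀ k s, ∑ r, μ.real {ω | I k ω = (s, r)} = 1 / (pb.angles.card : ℝ))
    (hp₂ : ∀ k r, ∑ s, μ.real {ω | I k ω = (s, r)} = 1 / (pb.delays.card : ℝ))
    (hc₁ : c₁ = pb.angles.card) (hc₂ : c₂ = pb.delays.card)
    (hx₀ : x₀ ∈ manifold N M) (hT0 : ∀ k, 0 ≤ T k)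
    (hT2 : Summable fun k => T k ^ 2) (hT1 : ¬ Summable T) :
    ∀ᵐ ω ∂μ,
      (∃ c, Tendsto (fun k => objective pb (run pb c₁ c₂ T e x₀ (fun j => I j ω) k).2) atTop
        (𝓝 c)) ∧
      Tendsto (fun k => grad (objective pb) (run pb c₁ c₂ T e x₀ (fun j => I j ω) k).2) atTop
        (𝓝 0) := by
  have hzero : ∀ k s, ∑ i, μ.real {ω | I k ω = i} • runNoise pb c₁ c₂ T e x₀ s k i = 0 := by
    intro k s
    rw [hc₁, hc₂]
    exact sum_smul_noise_eq_zero pb (hp₁ k) (hp₂ k) _ _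
  obtain ⟨R, hR⟩ := (isCompact_UM (N := N) (M := M)).isBounded.exists_norm_le
  have hdist : ∀ k s, ‖(run pb c₁ c₂ T e x₀ s k).2 - (run pb c₁ c₂ T e x₀ s k).1‖ ≤
      (2 * (1 + |R|)) * growth pb c₁ c₂ T e x₀ s k := by
    intro k s
    have hg := one_le_growth (pb := pb) (c₁ := c₁) (c₂ := c₂) (T := T) (e := e) (x₀ := x₀)
      (s := s) k
    have hpt : ∀ z ∈ manifold N M, 1 + |z.1| ≤ growth pb c₁ c₂ T e x₀ s k →
        ‖z‖ ≤ (1 + |R|) * growth pb c₁ c₂ T e x₀ s k := by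
      intro z hz hz'
      refine max_le ?_ ?_
      · rw [Real.norm_eq_abs]
        nlinarith [abs_nonneg R]
      · have := (hR z.2 hz).trans (le_abs_self R)
        nlinarith [abs_nonneg R]
    have h1 := hpt _ (run_mem_manifold hx₀ k).2 (iterate_le_growth k)
    have h2 := hpt _ (run_mem_manifold hx₀ k).1 (reference_le_growth k)
    linarith [norm_sub_le (run pb c₁ c₂ T e x₀ s k).2 (run pb c₁ c₂ T e x₀ s k).1]
  have hbig : ∀ (K : ℕ), ∃ B, 0 ≤ B ∧ ∀ k s i, growth pb c₁ c₂ T e x₀ s k ≤ K →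
      ‖runNoise pb c₁ c₂ T e x₀ s k i‖ ≤ B := by
    intro K
    obtain ⟨L, hL0, hL⟩ := exists_norm_noise_le (N := N) pb c₁ c₂ K
    refine ⟨L * ((2 * (1 + |R|)) * K), by positivity, fun k s i hk => ?_⟩
    refine (hL i _ (run_mem_slab hx₀ hk).1 _ (run_mem_slab hx₀ hk).2).trans ?_
    exact mul_le_mul_of_nonneg_left ((hdist k s).trans
      (mul_le_mul_of_nonneg_left hk (by positivity))) hL0
  have h₁ : ∀ᵐ ω ∂μ, SeriesConverges fun k => T k *
      ((runNoise pb c₁ c₂ T e x₀ (fun j => I j ω) k (I k ω)).1 /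
        growth pb c₁ c₂ T e x₀ (fun j => I j ω) k) := by
    obtain ⟨L, hL0, hL⟩ := exists_abs_noise_fst_le (N := N) pb c₁ c₂
    refine ae_seriesConverges_real hI hind
      (φ := fun k s i => (runNoise pb c₁ c₂ T e x₀ s k i).1 / growth pb c₁ c₂ T e x₀ s k)
      (fun k i s s' h => ?_) (C := L * (2 * (1 + |R|))) (fun k s i => ?_) (fun k s => ?_) hT2
    · have h2 : growth pb c₁ c₂ T e x₀ s k = growth pb c₁ c₂ T e x₀ s' k := growth_dependsOn k h
      have h3 : runNoise pb c₁ c₂ T e x₀ s k i = runNoise pb c₁ c₂ T e x₀ s' k i :=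
        runNoise_dependsOn k i h
      simp only [h2, h3]
    · have h0 : 0 < growth pb c₁ c₂ T e x₀ s k := one_pos.trans_le (one_le_growth k)
      rw [abs_div, abs_of_pos h0, div_le_iff₀ h0, mul_assoc]
      exact (hL i _ (run_mem_manifold hx₀ k).1 _ (run_mem_manifold hx₀ k).2).trans
        (mul_le_mul_of_nonneg_left (hdist k s) hL0)
    · have h := congrArg Prod.fst (hzero k s)
      simp only [Prod.fst_sum, Prod.smul_fst, smul_eq_mul, Prod.fst_zero] at h
      simp only [← mul_div_assoc]
      rw [← sum_div, h, zero_div]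
  have h₂ : ∀ᵐ ω ∂μ, ∀ K : ℕ, SeriesConverges fun k => T k •
      if growth pb c₁ c₂ T e x₀ (fun j => I j ω) k ≤ K then
        runNoise pb c₁ c₂ T e x₀ (fun j => I j ω) k (I k ω) else 0 := by
    refine ae_all_iff.2 fun K => ?_
    obtain ⟨B, hB0, hB⟩ := hbig K
    refine ae_seriesConverges hI hind
      (φ := fun k s i => if growth pb c₁ c₂ T e x₀ s k ≤ K then
        runNoise pb c₁ c₂ T e x₀ s k i else 0)
      (fun k i s s' h => ?_) (C := B) (fun k s i => ?_) (fun k s => ?_) hT2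
    · have h2 : growth pb c₁ c₂ T e x₀ s k = growth pb c₁ c₂ T e x₀ s' k := growth_dependsOn k h
      have h3 : runNoise pb c₁ c₂ T e x₀ s k i = runNoise pb c₁ c₂ T e x₀ s' k i :=
        runNoise_dependsOn k i h
      simp only [h2, h3]
    · split_ifs with h
      · exact hB k s i h
      · rwa [norm_zero]
    · split_ifs
      · exact hzero k s
      · simp
  have h₃ : ∀ᵐ ω ∂μ, ∀ K : ℕ, SeriesConverges fun k => T k •
      if growth pb c₁ c₂ T e x₀ (fun j => I j ω) k ≤ K then
        metric (grad (objective pb) (run pb c₁ c₂ T e x₀ (fun j => I j ω) k).2)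
          (runNoise pb c₁ c₂ T e x₀ (fun j => I j ω) k (I k ω)) else 0 := by
    refine ae_all_iff.2 fun K => ?_
    obtain ⟨B, hB0, hB⟩ := hbig K
    obtain ⟨A, hA0, hA⟩ := (quadraticIn_objective (N := N) pb).exists_norm_grad_le
    refine ae_seriesConverges hI hind
      (φ := fun k s i => if growth pb c₁ c₂ T e x₀ s k ≤ K then
        metric (grad (objective pb) (run pb c₁ c₂ T e x₀ s k).2)
          (runNoise pb c₁ c₂ T e x₀ s k i) else 0)
      (fun k i s s' h => ?_) (C := 2 * (A * K) * B) (fun k s i => ?_) (fun k s => ?_) hT2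
    · have h1 : run pb c₁ c₂ T e x₀ s k = run pb c₁ c₂ T e x₀ s' k := run_dependsOn k h
      have h2 : growth pb c₁ c₂ T e x₀ s k = growth pb c₁ c₂ T e x₀ s' k := growth_dependsOn k h
      have h3 : runNoise pb c₁ c₂ T e x₀ s k i = runNoise pb c₁ c₂ T e x₀ s' k i :=
        runNoise_dependsOn k i h
      simp only [h1, h2, h3]
    · split_ifs with h
      · refine (abs_metric_le _ _).trans ?_
        have h1 := (hA _ (run_mem_manifold (T := T) (e := e) (s := s) (pb := pb) (c₁ := c₁)
          (c₂ := c₂) hx₀ k).2).trans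
          (mul_le_mul_of_nonneg_left ((iterate_le_growth k).trans h) hA0)
        exact mul_le_mul (mul_le_mul_of_nonneg_left h1 two_pos.le) (hB k s i h) (norm_nonneg _)
          (by positivity)
      · rw [norm_zero]; positivity
    · split_ifs
      · have h := congrArg (metricL (grad (objective pb) (run pb c₁ c₂ T e x₀ s k).2)) (hzero k s)
        rw [map_sum, map_zero] at h
        simp only [map_smul] at h
        exact h
      · simp
  filter_upwards [h₁, h₂, h₃] with ω hω₁ hω₂ hω₃
  exact run_tendsto hx₀ hT0 hT2 hT1 hω₁ hω₂ hω₃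

end Run

end UMSVRG

/-! ### Consecutive numbering of the inner iterations -/

namespace UMSVRG

/-- The outer and the inner number of the step `k`. -/
def blockIndex (m : ℕ → ℕ) : ℕ → ℕ × ℕ
  | 0 => (0, 0)
  | k + 1 =>
    let p := blockIndex m k
    if p.2 + 1 < m p.1 then (p.1, p.2 + 1) else (p.1 + 1, 0)

/-- The step `k` is the last one of its inner loop. -/
def blockEnd (m : ℕ → ℕ) (k : ℕ) : Bool :=
  ¬ (blockIndex m k).2 + 1 < m (blockIndex m k).1

/-- The number of the first step of the inner loop `l`. -/
def blockStart (m : ℕ → ℕ) (l : ℕ) : ℕ := ∑ j ∈ range l, m j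

variable {m : ℕ → ℕ}

theorem blockStart_succ (l : ℕ) : blockStart m (l + 1) = blockStart m l + m l :=
  sum_range_succ _ _

theorem le_blockStart (hm : ∀ l, 0 < m l) (l : ℕ) : l ≤ blockStart m l := by
  induction l with
  | zero => exact Nat.zero_le _
  | succ l ih => rw [blockStart_succ]; have := hm l; omega

theorem blockIndex_snd_lt (hm : ∀ l, 0 < m l) (k : ℕ) :
    (blockIndex m k).2 < m (blockIndex m k).1 := by
  induction k with
  | zero => exact hm 0
  | succ k ih =>
    simp only [blockIndex]
    split_ifs with h
    exacts [h, hm _]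

theorem blockStart_add_blockIndex (hm : ∀ l, 0 < m l) (k : ℕ) :
    blockStart m (blockIndex m k).1 + (blockIndex m k).2 = k := by
  induction k with
  | zero => rfl
  | succ k ih =>
    have h1 := blockIndex_snd_lt hm k
    simp only [blockIndex]
    split_ifs with h
    · dsimp only; omega
    · rw [blockStart_succ]; omega

theorem blockIndex_blockStart_add (hm : ∀ l, 0 < m l) (l : ℕ) :
    ∀ q < m l, blockIndex m (blockStart m l + q) = (l, q) := by
  have key : ∀ l, blockIndex m (blockStart m l) = (l, 0) → ∀ q < m l,
      blockIndex m (blockStart m l + q) = (l, q) := by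
    intro l h q
    induction q with
    | zero => exact fun _ => h
    | succ q ih =>
      intro hq
      rw [← add_assoc, blockIndex, ih (by omega)]
      exact if_pos hq
  refine key l ?_
  induction l with
  | zero => rfl
  | succ l ih =>
    have h1 := hm l
    have h2 : blockStart m (l + 1) = blockStart m l + (m l - 1) + 1 := by
      rw [blockStart_succ]; omega
    rw [h2, blockIndex, key l ih (m l - 1) (by omega)]
    exact if_neg (by dsimp only; omega)

theorem sum_range_blockStart (G : ℕ → ℝ) (L : ℕ) :
    ∑ k ∈ range (blockStart m L), G k =
      ∑ l ∈ range L, ∑ q ∈ range (m l), G (blockStart m l + q) := by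
  induction L with
  | zero => simp [blockStart]
  | succ L ih => rw [blockStart_succ, sum_range_add, ih, sum_range_succ]

theorem elapsed_blockStart_add (hm : ∀ l, 0 < m l) (T : ℕ → ℝ) (l : ℕ) :
    ∀ q < m l, elapsed T (blockEnd m) (blockStart m l + q) =
      ∑ j ∈ range q, T (blockStart m l + j) := by
  intro q
  induction q with
  | zero =>
    intro _
    rcases l with _ | l
    · rfl
    · have h1 := hm l
      have h2 : blockStart m (l + 1) + 0 = blockStart m l + (m l - 1) + 1 := by
        rw [blockStart_succ]; omega
      have h3 : blockEnd m (blockStart m l + (m l - 1)) = true := by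
        rw [blockEnd, blockIndex_blockStart_add hm l _ (by omega)]
        simp only [decide_eq_true_eq]
        omega
      rw [h2, elapsed, if_pos h3, range_zero, sum_empty]
  | succ q ih =>
    intro hq
    have h3 : ¬ blockEnd m (blockStart m l + q) = true := by
      rw [blockEnd, blockIndex_blockStart_add hm l _ (by omega)]
      simpa using hq
    rw [← add_assoc, elapsed, if_neg h3, ih (by omega), sum_range_succ]

/-- With bounded lengths of the inner loops, square summability of the step sizes makes the products
of a step size and the time elapsed in its inner loop summable. -/
theorem summable_mul_elapsed (hm : ∀ l, 0 < m l) (hbdd : BddAbove (Set.range m)) {T : ℕ → ℝ}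
    (hT0 : ∀ k, 0 ≤ T k) (hT2 : Summable fun k => T k ^ 2) :
    Summable fun k => T k * elapsed T (blockEnd m) k := by
  obtain ⟨B, hB⟩ := hbdd
  have hnn : ∀ k, 0 ≤ T k * elapsed T (blockEnd m) k :=
    fun k => mul_nonneg (hT0 k) (elapsed_nonneg hT0 k)
  refine summable_of_sum_range_le (c := B * ∑' k, T k ^ 2) hnn fun n => ?_
  have hblock : ∀ l, ∑ q ∈ range (m l), T (blockStart m l + q) *
      elapsed T (blockEnd m) (blockStart m l + q) ≤
        B * ∑ q ∈ range (m l), T (blockStart m l + q) ^ 2 := by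
    intro l
    calc _ ≤ ∑ q ∈ range (m l), T (blockStart m l + q) *
          ∑ j ∈ range (m l), T (blockStart m l + j) := by
          refine sum_le_sum fun q hq => mul_le_mul_of_nonneg_left ?_ (hT0 _)
          rw [elapsed_blockStart_add hm T l q (mem_range.1 hq)]
          exact sum_le_sum_of_subset_of_nonneg
            (range_subset_range.2 (mem_range.1 hq).le) fun _ _ _ => hT0 _
      _ = (∑ q ∈ range (m l), T (blockStart m l + q)) ^ 2 := by rw [← sum_mul, sq]
      _ ≤ (m l : ℝ) * ∑ q ∈ range (m l), T (blockStart m l + q) ^ 2 := by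
          simpa using sq_sum_le_card_mul_sum_sq (s := range (m l))
            (f := fun q => T (blockStart m l + q))
      _ ≤ _ := by
          refine mul_le_mul_of_nonneg_right ?_ (sum_nonneg fun _ _ => sq_nonneg _)
          exact_mod_cast hB ⟨l, rfl⟩
  calc _ ≤ ∑ k ∈ range (blockStart m n), T k * elapsed T (blockEnd m) k :=
        sum_le_sum_of_subset_of_nonneg (range_subset_range.2 (le_blockStart hm n))
          fun _ _ _ => hnn _
    _ ≤ ∑ l ∈ range n, B * ∑ q ∈ range (m l), T (blockStart m l + q) ^ 2 := by
        rw [sum_range_blockStart]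
        exact sum_le_sum fun l _ => hblock l
    _ = B * ∑ k ∈ range (blockStart m n), T k ^ 2 := by rw [← mul_sum, sum_range_blockStart]
    _ ≤ _ := mul_le_mul_of_nonneg_left (hT2.sum_le_tsum _ fun _ _ => sq_nonneg _)
        (Nat.cast_nonneg B)

variable {N M : ℕ} {pb : Problem M}

/-- The consecutively numbered run passes through the iterates of the nested loops. -/
theorem run_eq_iterate (hm : ∀ l, 0 < m l) (c₁ c₂ : ℝ) (t : ℕ → ℕ → ℝ)
    (i : ℕ → ℕ → pb.angles × pb.delays) (x₀ : Pt N M) (l q : ℕ) (hq : q ≤ m l) :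
    (run pb c₁ c₂ (fun k => t (blockIndex m k).1 (blockIndex m k).2) (blockEnd m) x₀
      (fun k => i (blockIndex m k).1 (blockIndex m k).2) (blockStart m l + q)).2 =
        iterate pb c₁ c₂ m t i x₀ l q := by
  set z := run pb c₁ c₂ (fun k => t (blockIndex m k).1 (blockIndex m k).2) (blockEnd m) x₀
      (fun k => i (blockIndex m k).1 (blockIndex m k).2) with hz
  set o := outerLoop pb c₁ c₂ m t i x₀ with ho
  have hstep : ∀ l, ∀ q < m l, z (blockStart m l + q) = (o l, iterate pb c₁ c₂ m t i x₀ l q) →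
      (z (blockStart m l + q + 1)).2 = iterate pb c₁ c₂ m t i x₀ l (q + 1) := by
    intro l q hq h
    change retract (z _).2 (-(t (blockIndex m _).1 (blockIndex m _).2) • modGrad pb c₁ c₂
      (i (blockIndex m _).1 (blockIndex m _).2) (z _).1 (z _).2) = _
    rw [h, blockIndex_blockStart_add hm l q hq]
    rfl
  have hinner : ∀ l, z (blockStart m l) = (o l, o l) → ∀ q < m l,
      z (blockStart m l + q) = (o l, iterate pb c₁ c₂ m t i x₀ l q) := by
    intro l h q
    induction q with
    | zero => exact fun _ => h
    | succ q ih =>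
      intro hq
      have h1 := ih (by omega)
      refine Prod.ext ?_ (hstep l q (by omega) h1)
      have h3 : ¬ blockEnd m (blockStart m l + q) = true := by
        rw [blockEnd, blockIndex_blockStart_add hm l _ (by omega)]
        simpa using hq
      have h4 : (z (blockStart m l + q + 1)).1 = (z (blockStart m l + q)).1 := if_neg h3
      rw [← add_assoc, h4, h1]
  have hlast : ∀ l, z (blockStart m l) = (o l, o l) →
      z (blockStart m l + (m l - 1) + 1) = (o (l + 1), o (l + 1)) := by
    intro l h
    have h1 := hm l
    have h2 := hstep l (m l - 1) (by omega) (hinner l h _ (by omega))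
    rw [Nat.sub_add_cancel h1] at h2
    have h3 : blockEnd m (blockStart m l + (m l - 1)) = true := by
      rw [blockEnd, blockIndex_blockStart_add hm l _ (by omega)]
      simp only [decide_eq_true_eq]
      omega
    have h4 : (z (blockStart m l + (m l - 1) + 1)).1 = (z (blockStart m l + (m l - 1) + 1)).2 :=
      if_pos h3
    exact Prod.ext (h4.trans h2) h2
  have hstart : ∀ l, z (blockStart m l) = (o l, o l) := by
    intro l
    induction l with
    | zero => rfl
    | succ l ih =>
      have h1 := hm l
      rw [← hlast l ih, blockStart_succ]
      congr 1
      omega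
  rcases hq.lt_or_eq with h | h
  · rw [hinner l (hstart l) q h]
  · rw [h, ← blockStart_succ, hstart]
    rfl

/-- Each step number belongs to finitely many (in fact at most two) index pairs `(l, q)` with
`q ≤ m l`. -/
theorem tendsto_blockStart_add (hm : ∀ l, 0 < m l) :
    Tendsto (fun p : (Σ l : ℕ, Fin (m l + 1)) => blockStart m p.1 + p.2) cofinite atTop := by
  refine tendsto_atTop.2 fun n => ?_
  refine ((Finset.range n).sigma fun l => (univ : Finset (Fin (m l + 1)))).finite_toSet.subset ?_
  intro p hp
  have h1 : ¬ n ≤ blockStart m p.1 + p.2 := hp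
  have h2 := le_blockStart hm p.1
  simp only [coe_sigma, Set.mem_sigma_iff, mem_coe, mem_range, mem_univ, and_true]
  omega

end UMSVRG

/-! ### Convergence of the algorithm -/

theorem theorem2 {N M : ℕ} (pb : UMSVRG.Problem M)
    -- scaling of the sampled losses, numbers of inner iterations, step sizes, initial point
    (c₁ c₂ : ℝ) (m : ℕ → ℕ) (hm : ∀ l, 0 < m l)
    (t : ℕ → ℕ → ℝ) (ht : ∀ l, ∀ q < m l, 0 < t l q)
    (x₀ : UMSVRG.Pt N M) (hx₀ : x₀ ∈ UMSVRG.manifold N M)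
    -- the random samples: uniform, and independent from one iteration to another
    {Ω : Type*} [MeasurableSpace Ω] (μ : Measure Ω) [IsProbabilityMeasure μ]
    (θ : ℕ → ℕ → Ω → pb.angles) (τ : ℕ → ℕ → Ω → pb.delays)
    (hθm : ∀ l, ∀ q < m l, Measurable (θ l q)) (hτm : ∀ l, ∀ q < m l, Measurable (τ l q))
    (hθ : ∀ l, ∀ q < m l, ∀ s, μ.real {ω | θ l q ω = s} = 1 / (pb.angles.card : ℝ))
    (hτ : ∀ l, ∀ q < m l, ∀ s, μ.real {ω | τ l q ω = s} = 1 / (pb.delays.card : ℝ))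
    (hind : iIndepFun
      (fun (p : Σ l : ℕ, Fin (m l)) (ω : Ω) => (θ p.1 p.2 ω, τ p.1 p.2 ω)) μ)
    -- the step size conditions
    (hsq : Summable fun l => ∑ q ∈ Finset.range (m l), t l q ^ 2)
    (hdiv : Tendsto (fun L => ∑ l ∈ Finset.range L, ∑ q ∈ Finset.range (m l), t l q) atTop atTop)
    -- unbiased sampled losses, or bounded numbers of inner iterations
    (hc : (c₁ = pb.angles.card ∧ c₂ = pb.delays.card) ∨ BddAbove (Set.range m)) :
    ∀ᵐ ω ∂μ,
      let x : (Σ l : ℕ, Fin (m l + 1)) → UMSVRG.Pt N M := fun p =>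
        UMSVRG.iterate pb c₁ c₂ m t (fun l q => (θ l q ω, τ l q ω)) x₀ p.1 p.2
      (∃ c : ℝ, Tendsto (fun p => UMSVRG.objective pb (x p)) cofinite (𝓝 c)) ∧
      Tendsto (fun p => UMSVRG.grad (UMSVRG.objective pb) (x p)) cofinite (𝓝 0) ∧
      ∀ z, MapClusterPt z cofinite x →
        z ∈ UMSVRG.manifold N M ∧ UMSVRG.grad (UMSVRG.objective pb) z = 0 := by
  have : Nonempty Ω := nonempty_of_isProbabilityMeasure μ
  have : Nonempty pb.angles := this.map (θ 0 0)
  set T : ℕ → ℝ := fun k => t (UMSVRG.blockIndex m k).1 (UMSVRG.blockIndex m k).2 with hTdef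
  set I : ℕ → Ω → pb.angles × pb.delays := fun k ω =>
    (θ (UMSVRG.blockIndex m k).1 (UMSVRG.blockIndex m k).2 ω,
      τ (UMSVRG.blockIndex m k).1 (UMSVRG.blockIndex m k).2 ω) with hIdef
  have hlt := UMSVRG.blockIndex_snd_lt hm
  have hT0 : ∀ k, 0 ≤ T k := fun k => (ht _ _ (hlt k)).le
  have hTb : ∀ l, ∀ q < m l, T (UMSVRG.blockStart m l + q) = t l q := fun l q hq => by
    simp only [hTdef, UMSVRG.blockIndex_blockStart_add hm l q hq]
  have hT2 : Summable fun k => T k ^ 2 := by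
    refine summable_of_sum_range_le (c := ∑' l, ∑ q ∈ range (m l), t l q ^ 2)
      (fun k => sq_nonneg _) fun n => ?_
    calc _ ≤ ∑ k ∈ range (UMSVRG.blockStart m n), T k ^ 2 :=
          sum_le_sum_of_subset_of_nonneg (range_subset_range.2 (UMSVRG.le_blockStart hm n))
            fun _ _ _ => sq_nonneg _
      _ = ∑ l ∈ range n, ∑ q ∈ range (m l), t l q ^ 2 := by
          rw [UMSVRG.sum_range_blockStart]
          exact sum_congr rfl fun l _ => sum_congr rfl fun q hq => by
            rw [hTb l q (mem_range.1 hq)]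
      _ ≤ _ := hsq.sum_le_tsum _ fun _ _ => sum_nonneg fun _ _ => sq_nonneg _
  have hT1 : ¬ Summable T := by
    intro hs
    obtain ⟨L, hL⟩ := (hdiv.eventually_gt_atTop (∑' k, T k)).exists
    have h1 : ∑ k ∈ range (UMSVRG.blockStart m L), T k ≤ ∑' k, T k :=
      hs.sum_le_tsum _ fun k _ => hT0 k
    rw [UMSVRG.sum_range_blockStart, sum_congr rfl fun l _ => sum_congr rfl fun q hq =>
      hTb l q (mem_range.1 hq)] at h1
    exact absurd h1 (not_le.2 hL)
  have hrun : ∀ᵐ ω ∂μ,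
      (∃ c, Tendsto (fun k => UMSVRG.objective pb
        (UMSVRG.run pb c₁ c₂ T (UMSVRG.blockEnd m) x₀ (fun j => I j ω) k).2) atTop (𝓝 c)) ∧
      Tendsto (fun k => UMSVRG.grad (UMSVRG.objective pb)
        (UMSVRG.run pb c₁ c₂ T (UMSVRG.blockEnd m) x₀ (fun j => I j ω) k).2) atTop (𝓝 0) := by
    rcases hc with ⟨hc₁, hc₂⟩ | hbdd
    · have hI : ∀ k, Measurable (I k) := fun k => (hθm _ _ (hlt k)).prodMk (hτm _ _ (hlt k))
      have hindI : iIndepFun I μ := by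
        refine hind.precomp (g := fun k => (⟨_, _, hlt k⟩ : Σ l : ℕ, Fin (m l))) fun k k' h => ?_
        have h1 := congrArg (fun p : (Σ l : ℕ, Fin (m l)) => UMSVRG.blockStart m p.1 + p.2) h
        simpa only [UMSVRG.blockStart_add_blockIndex hm] using h1
      refine UMSVRG.ae_run_tendsto hI hindI (fun k s => ?_) (fun k r => ?_) hc₁ hc₂ hx₀ hT0 hT2 hT1
      · rw [← hθ _ _ (hlt k) s, ← measureReal_biUnion_finset]
        · congr 1
          ext ω
          simp [hIdef]
        · exact fun r _ r' _ hrr => Set.disjoint_left.2 fun ω (h : I k ω = _) (h' : I k ω = _) =>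
            hrr (congrArg Prod.snd (h.symm.trans h'))
        · exact fun r _ => hI k (measurableSet_singleton _)
      · rw [← hτ _ _ (hlt k) r, ← measureReal_biUnion_finset]
        · congr 1
          ext ω
          simp [hIdef]
        · exact fun s _ s' _ hss => Set.disjoint_left.2 fun ω (h : I k ω = _) (h' : I k ω = _) =>
            hss (congrArg Prod.fst (h.symm.trans h'))
        · exact fun s _ => hI k (measurableSet_singleton _)
    · exact ae_of_all _ fun ω => UMSVRG.run_tendsto_of_summable_elapsed hx₀ hT0 hT2 hT1
        (UMSVRG.summable_mul_elapsed hm hbdd hT0 hT2)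
  filter_upwards [hrun] with ω hω
  intro x
  have hx : x = fun p => (UMSVRG.run pb c₁ c₂ T (UMSVRG.blockEnd m) x₀ (fun j => I j ω)
      (UMSVRG.blockStart m p.1 + p.2)).2 := funext fun p =>
    (UMSVRG.run_eq_iterate hm c₁ c₂ t (fun l q => (θ l q ω, τ l q ω)) x₀ p.1 p.2
      (Nat.lt_succ_iff.1 p.2.2)).symm
  have hκ := UMSVRG.tendsto_blockStart_add hm
  have hgrad : Tendsto (fun p => UMSVRG.grad (UMSVRG.objective pb) (x p)) cofinite (𝓝 0) := by
    rw [hx]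
    exact hω.2.comp hκ
  refine ⟨?_, hgrad, fun z hz => ⟨?_, ?_⟩⟩
  · obtain ⟨c, hc⟩ := hω.1
    rw [hx]
    exact ⟨c, hc.comp hκ⟩
  · refine UMSVRG.isClosed_manifold.mem_of_mapClusterPt hz (Eventually.of_forall fun p => ?_)
    rw [hx]
    exact (UMSVRG.run_mem_manifold hx₀ _).2
  · have hcont : Continuous (UMSVRG.grad (N := N) (UMSVRG.objective pb)) :=
      (UMSVRG.contDiff_grad (UMSVRG.quadraticIn_objective pb).contDiff).continuous
    have h1 : ClusterPt (UMSVRG.grad (UMSVRG.objective pb) z) (𝓝 0) :=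
      ClusterPt.mono (hz.continuousAt_comp hcont.continuousAt) hgrad
    exact eq_of_nhds_neBot h1
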